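/- Let $S_\infty$ be the group of all permutations of $\mathbb{N}$, topologized through the injection $g\mapsto g(0)\,g^{-1}(0)\,g(1)\,g^{-1}(1)\cdots$ into Baire space $\mathbb{N}^{\mathbb{N}}$. For a subgroup $G\le S_\infty$ let $T_G\subseteq\mathbb{N}^{<\omega}$ be the set of all finite sequences $g(0)g^{-1}(0)g(1)g^{-1}(1)\cdots g(n)g^{-1}(n)$ with $g\in G$, $n\in\mathbb{N}$, ordered by initial segments. $T_G$ is called computable if both its domain and the branching function $Br:T_G\to\mathbb{N}\cup\{\infty\}$, which gives the number of direct successors of a node in $T_G$, are computable. For profinite $G$ enumerate the orbits of $G$ on $\mathbb{N}$ as $O_{G,0},O_{G,1},\dots$, where $O_{G,k}$ is the orbit of the least natural number that lies in no $O_{G,m}$ with $m<k$, and let $H_k=\{g\upharpoonright O_{G,k}: g\in G\}$. $G$ has orbit independence if $G\cong\prod_{k\in\mathbb{N}}H_k$ as groups. The existential theory of $G$ is the set of (Gödel numbers of) sentences $\exists\bar x\,\beta(\bar x)$, with $\beta$ a quantifier-free formula in the language of groups $(1,{}^{-1},\cdot)$, that are true in $G$. A set $A\subseteq\mathbb{N}$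 is $\Sigma^0_2$ if there is a decidable relation $R$ with $x\in A\iff\exists a\,\forall b\,R(x,a,b)$ for all $x$; it is $\Sigma^0_2$-complete if it is $\Sigma^0_2$ and every $\Sigma^0_2$ set is one-one reducible (in particular many-one reducible) to it. Let $W_e$ be the domain of the $e$-th partial computable function, $\mathrm{Fin}=\{e: W_e\text{ is finite}\}$, and let $p_0<p_1<\cdots$ be the primes. **Proposition.** There is a subgroup $G$ of $S_\infty$ that is profinite (as a topological group with the subspace topology), does not have orbit independence, and has $T_G$ computable, such that the existential theory of $G$ is $\Sigma^0_2$-complete. Moreover, $G$ can be chosen so that, for every $n\in\mathbb{N}$, $$G\models(\exists x)\,[x\neq 1\wedge x^{p_n}=1]\iff n\in\mathrm{Fin}.$$ -/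

import Mathlib

open FirstOrder

namespace PermTree

/-- The infinite sequence `g(0) g⁻¹(0) g(1) g⁻¹(1) ⋯` attached to a permutation `g` of `ℕ`. -/
def path (g : Equiv.Perm ℕ) (k : ℕ) : ℕ :=
  if Even k then g (k / 2) else g⁻¹ (k / 2)

/-- The topology of `S_∞`: the one induced from Baire space `ℕ → ℕ` (product of discrete
spaces) by the injection `g ↦ path g`. -/
instance instTopologicalSpacePerm : TopologicalSpace (Equiv.Perm ℕ) :=
  TopologicalSpace.induced path inferInstance

/-- A subgroup of `S_∞` is profinite if, as a topological group, it is isomorphic to a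
profinite group. -/
def IsProfiniteSubgroup (G : Subgroup (Equiv.Perm ℕ)) : Prop :=
  ∃ P : ProfiniteGrp.{0}, Nonempty (G ≃ₜ* P)

/-- The tree `T_G` of all finite sequences `g(0) g⁻¹(0) ⋯ g(n) g⁻¹(n)` with `g ∈ G`, `n ∈ ℕ`. -/
def tree (G : Subgroup (Equiv.Perm ℕ)) : Set (List ℕ) :=
  {τ | ∃ g ∈ G, ∃ n : ℕ, τ = (List.range (2 * (n + 1))).map (path g)}

/-- The direct successors of `τ` in `T`, with `T` ordered by initial segments. -/
def directSuccessors (T : Set (List ℕ)) (τ : List ℕ) : Set (List ℕ) :=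
  {σ | σ ∈ T ∧ τ <+: σ ∧ τ ≠ σ ∧ ∀ ρ ∈ T, τ <+: ρ → ρ <+: σ → ρ = τ ∨ ρ = σ}

/-- `T` is computable (has degree `0`): its domain is decidable, and the branching function
`Br : T → ℕ ∪ {∞}` counting direct successors is computable (`none` stands for `∞`). -/
def IsComputableTree (T : Set (List ℕ)) : Prop :=
  ComputablePred (fun τ : List ℕ => τ ∈ T) ∧
    ∃ br : List ℕ → Option ℕ, Computable br ∧
      ∀ τ ∈ T, (directSuccessors T τ).encard = (br τ).elim ⊤ (fun m => (m : ℕ∞))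

/-- `orbitRep G k` is the least natural number lying in none of the earlier orbits
`orb_G (orbitRep G m)`, `m < k`. -/
noncomputable def orbitRep (G : Subgroup (Equiv.Perm ℕ)) (k : ℕ) : ℕ :=
  sInf {x : ℕ | ∀ m : Fin k, x ∉ MulAction.orbit G (orbitRep G m)}
termination_by k
decreasing_by exact m.2

/-- The `k`-th orbit `O_{G,k}` of `G` on `ℕ`. -/
noncomputable def orbitSet (G : Subgroup (Equiv.Perm ℕ)) (k : ℕ) : Set ℕ :=
  MulAction.orbit G (orbitRep G k)

/-- The group `H_k` of all restrictions to `O_{G,k}` of elements of `G`. -/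
noncomputable def orbitGroup (G : Subgroup (Equiv.Perm ℕ)) (k : ℕ) : Subgroup (Equiv.Perm (orbitSet G k)) :=
  (MulAction.toPermHom G (MulAction.orbit G (orbitRep G k))).range

/-- Orbit independence: `G` is isomorphic to the Cartesian product of all the `H_k`. -/
def OrbitIndependent (G : Subgroup (Equiv.Perm ℕ)) : Prop :=
  Nonempty (G ≃* ((k : ℕ) → orbitGroup G k))

/-- Function symbols of the language of groups. -/
inductive GroupFunc : ℕ → Type
  | one : GroupFunc 0
  | inv : GroupFunc 1
  | mul : GroupFunc 2

/-- The first-order language of groups `(1, ⁻¹, ·)`. -/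
def groupLanguage : Language :=
  { Functions := GroupFunc
    Relations := fun _ => Empty }

/-- The symbol `1`, as a function symbol of `groupLanguage`. -/
abbrev oneFunc : groupLanguage.Functions 0 := GroupFunc.one

/-- The symbol `⁻¹`, as a function symbol of `groupLanguage`. -/
abbrev invFunc : groupLanguage.Functions 1 := GroupFunc.inv

/-- The symbol `·`, as a function symbol of `groupLanguage`. -/
abbrev mulFunc : groupLanguage.Functions 2 := GroupFunc.mul

/-- Every group is a structure for the language of groups. -/
instance groupStructure (G : Type*) [Group G] : groupLanguage.Structure G where
  funMap {_} f :=
    match f with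
    | GroupFunc.one => fun _ => 1
    | GroupFunc.inv => fun x => (x 0)⁻¹
    | GroupFunc.mul => fun x => x 0 * x 1
  RelMap {_} r := nomatch r

/-- Gödel numbers of terms of the language of groups with variables `x_0, …, x_{n-1}`. -/
def termCode {n : ℕ} : groupLanguage.Term (Empty ⊕ Fin n) → ℕ
  | .var (.inl e) => e.elim
  | .var (.inr i) => Nat.pair 0 i
  | .func GroupFunc.one _ => Nat.pair 1 0
  | .func GroupFunc.inv ts => Nat.pair 2 (termCode (ts 0))
  | .func GroupFunc.mul ts => Nat.pair 3 (Nat.pair (termCode (ts 0)) (termCode (ts 1)))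

/-- Gödel numbers of formulas of the language of groups with free variables among
`x_0, …, x_{n-1}`. -/
def formulaCode : {n : ℕ} → groupLanguage.BoundedFormula Empty n → ℕ
  | _, .falsum => Nat.pair 0 0
  | _, .equal t₁ t₂ => Nat.pair 1 (Nat.pair (termCode t₁) (termCode t₂))
  | _, .rel R _ => Empty.elim R
  | _, .imp φ ψ => Nat.pair 2 (Nat.pair (formulaCode φ) (formulaCode ψ))
  | _, .all φ => Nat.pair 3 (formulaCode φ)

/-- The existential theory of a group: the set of Gödel numbers of the existential sentences
(existential quantifiers in front of a quantifier-free formula) that are true in it. -/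
def existentialTheory (G : Type*) [Group G] : Set ℕ :=
  {c | ∃ φ : groupLanguage.Sentence, φ.IsExistential ∧ G ⊨ φ ∧ c = formulaCode φ}

/-- `A` is `Σ⁰₂`: it is defined by `∃ a ∀ b R(x, a, b)` with `R` decidable. -/
def IsSigma02 (A : Set ℕ) : Prop :=
  ∃ R : ℕ × ℕ × ℕ → Prop, ComputablePred R ∧ ∀ x, x ∈ A ↔ ∃ a, ∀ b, R (x, a, b)

/-- `A` is `Σ⁰₂`-complete: it is `Σ⁰₂`, and every `Σ⁰₂` set is one-one reducible (hence
many-one reducible) to it. -/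
def IsSigma02Complete (A : Set ℕ) : Prop :=
  IsSigma02 A ∧ ∀ B : Set ℕ, IsSigma02 B → OneOneReducible (fun x => x ∈ B) (fun x => x ∈ A)

/-- The term `t ^ k = (⋯(1 · t) · ⋯) · t`. -/
def powTerm {n : ℕ} (t : groupLanguage.Term (Empty ⊕ Fin n)) :
    ℕ → groupLanguage.Term (Empty ⊕ Fin n)
  | 0 => Language.Constants.term oneFunc
  | k + 1 => mulFunc.apply₂ (powTerm t k) t

/-- The sentence `(∃ x) [x ≠ 1 ∧ x ^ p = 1]`. -/
def torsionSentence (p : ℕ) : groupLanguage.Sentence :=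
  let x : groupLanguage.Term (Empty ⊕ Fin 1) := .var (.inr 0)
  Language.BoundedFormula.ex
    ((Language.Term.bdEqual x (powTerm x 0)).not ⊓
      Language.Term.bdEqual (powTerm x p) (powTerm x 0))

/-- `W_e`, the domain of the `e`-th partial computable function. -/
def W (e : ℕ) : Set ℕ :=
  {x | ((Denumerable.ofNat Nat.Partrec.Code e).eval x).Dom}

/-- `Fin = {e : W_e is finite}`. -/
def finSet : Set ℕ := {e | (W e).Finite}

end PermTree

/-! Through the pairing function, block `b = ⟨n, s⟩` of `ℕ` carries one cycle of length `p_n ^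
cycleExp n s`, and the other points of the block are fixed. The group is the closure in `S_∞` of the
cyclic group generated by the permutation that turns all cycles at once. It is a copy of
`procyclic`, a closed subgroup of a product of finite cyclic groups, hence profinite. On any first
`m` coordinates an element agrees with an integer, which matters only modulo the primitive recursive
number `periodLcm m`; this makes the tree computable (`mem_tree_iff_bounded`,
`encard_directSuccessors`).

The `p_n`-part of the group is a finite cyclic group when the exponents `cycleExp n s` are bounded,
and the torsion-free group of `p_n`-adic integers otherwise. Boundedness means that `W n` is finite,
so `p_n`-torsion exists iff `n ∈ Fin` (`cycleGroup_torsion_iff`). If `W n` is infinite, a single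
cycle of `p_n`-power length still produces `p_n`-torsion in the product of the `H_k`, so orbit
independence fails.

Hardness follows because `Fin` is `Σ⁰₂`-hard (`isSigma02_oneOneReducible_finSet`) and torsion
sentences have computable, injective Gödel numbers. For the upper bound, some `m` bounds the
coordinates in which the needed inequations are witnessed. With `m` fixed, compactness
(`exists_realize_iff`) reduces solvability to solvability of the equations in the first `M`
coordinates for every `M`, and each instance is a finite search over residues modulo `periodLcm M`
(`exists_approx_iff`). The prefix is `∃ m ∀ M`. -/

namespace PermTree

/-! ### Primitive recursiveness of the cycle lengths, and their link with `Fin`. -/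

section Primrec

theorem primrecPred_prime : PrimrecPred Nat.Prime := by
  have h : PrimrecRel fun m p : ℕ => ¬ (2 ≤ m ∧ p % m = 0) :=
    PrimrecPred.not <| PrimrecPred.and
      (Primrec.nat_le.comp (Primrec.const 2) Primrec.fst)
      (Primrec.eq.comp (Primrec.nat_mod.comp Primrec.snd Primrec.fst) (Primrec.const 0))
  refine (PrimrecPred.and (Primrec.nat_le.comp (Primrec.const 2) Primrec.id)
    (h.forall_lt.comp Primrec.id Primrec.id)).of_eq fun p => ?_
  rw [Nat.prime_def_lt']
  simp only [id, Nat.dvd_iff_mod_eq_zero]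
  exact and_congr_right fun _ => forall_congr' fun m => by tauto

/-- Bertrand's postulate bounds the search for the next prime by twice the current one, so the
enumeration of primes needs no unbounded search. -/
theorem nth_prime_succ_eq_findGreatest (n : ℕ) :
    Nat.nth Nat.Prime (n + 1) =
      Nat.findGreatest (fun x => ∀ y < x, y.Prime → y ≤ Nat.nth Nat.Prime n)
        (2 * Nat.nth Nat.Prime n) := by
  have hlt : Nat.nth Nat.Prime n < Nat.nth Nat.Prime (n + 1) :=
    Nat.nth_strictMono Nat.infinite_setOfPred_prime (Nat.lt_succ_self n)
  have hbetween : ∀ y < Nat.nth Nat.Prime (n + 1), y.Prime → y ≤ Nat.nth Nat.Prime n :=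
    fun y hy hp => Nat.le_nth_of_lt_nth_succ hy hp
  symm
  rw [Nat.findGreatest_eq_iff]
  refine ⟨?_, fun _ => hbetween, fun x hx _ h => ?_⟩
  · obtain ⟨r, hr, h1, h2⟩ := Nat.exists_prime_lt_and_le_two_mul (Nat.nth Nat.Prime n)
      (Nat.prime_nth_prime n).ne_zero
    by_contra! hcon
    exact absurd (hbetween r (h2.trans_lt hcon) hr) (not_le.2 h1)
  · exact absurd (h _ hx (Nat.prime_nth_prime (n + 1))) (not_le.2 hlt)

theorem primrec_nth_prime : Primrec (Nat.nth Nat.Prime) := by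
  classical
  have hrel : PrimrecRel fun p x : ℕ => ∀ y < x, y.Prime → y ≤ p := by
    have h : PrimrecRel fun y p : ℕ => ¬ y.Prime ∨ y ≤ p :=
      PrimrecPred.or (primrecPred_prime.comp Primrec.fst).not Primrec.nat_le
    exact (h.forall_lt.comp Primrec.snd Primrec.fst).of_eq fun a =>
      forall_congr' fun y => forall_congr' fun _ => imp_iff_not_or.symm
  have hnext : Primrec fun p : ℕ =>
      Nat.findGreatest (fun x => ∀ y < x, y.Prime → y ≤ p) (2 * p) :=
    Primrec.nat_findGreatest (Primrec.nat_mul.comp (Primrec.const 2) Primrec.id) hrel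
  refine (Primrec.nat_rec₁ 2 (hnext.comp Primrec.snd).to₂).of_eq fun n => ?_
  induction n with
  | zero => exact Nat.nth_prime_zero_eq_two.symm
  | succ n ih =>
    rw [nth_prime_succ_eq_findGreatest]
    simp only [← ih]

theorem primrec_pow : Primrec₂ ((· ^ ·) : ℕ → ℕ → ℕ) :=
  Primrec₂.unpaired'.1 Nat.Primrec.pow

theorem primrec_gcd : Primrec₂ Nat.gcd := by
  have hdvd : PrimrecRel fun a d : ℕ => a % d = 0 :=
    Primrec.eq.comp (Primrec.nat_mod.comp Primrec.fst Primrec.snd) (Primrec.const 0)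
  have h : PrimrecRel fun (a : ℕ × ℕ) (d : ℕ) => a.1 % d = 0 ∧ a.2 % d = 0 :=
    PrimrecPred.and (hdvd.comp (Primrec.fst.comp Primrec.fst) Primrec.snd)
      (hdvd.comp (Primrec.snd.comp Primrec.fst) Primrec.snd)
  refine (Primrec.nat_findGreatest (f := fun a : ℕ × ℕ => a.1 + a.2) Primrec.nat_add h).of_eq ?_
  rintro ⟨a, b⟩
  rw [Nat.findGreatest_eq_iff]
  simp only [← Nat.dvd_iff_mod_eq_zero]
  refine ⟨?_, fun _ => ⟨Nat.gcd_dvd_left a b, Nat.gcd_dvd_right a b⟩, fun d hd hle h => ?_⟩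
  -- The bound `a + b` vanishes only for `a = b = 0`, where the default value `0` of the search is
  -- the gcd.
  · rcases Nat.eq_zero_or_pos a with rfl | ha
    · simp
    · exact (Nat.gcd_le_left b ha).trans (Nat.le_add_right a b)
  · have := Nat.dvd_gcd h.1 h.2
    rcases Nat.eq_zero_or_pos (Nat.gcd a b) with h0 | h0
    · rw [Nat.gcd_eq_zero_iff] at h0
      omega
    · exact absurd (Nat.le_of_dvd h0 this) (not_le.2 hd)

theorem primrec_lcm : Primrec₂ Nat.lcm :=
  Primrec.nat_div.comp Primrec.nat_mul primrec_gcd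

/-- The exponent of the `n`-th prime in the length of the `s`-th cycle attached to it: one more
than the largest element of `W n` that is enumerated within `s` steps. -/
def cycleExp (n s : ℕ) : ℕ :=
  1 + Nat.findGreatest
    (fun x => ((Denumerable.ofNat Nat.Partrec.Code n).evaln s x).isSome = true) s

/-- The length of the `b`-th cycle. -/
noncomputable def cycleLen (b : ℕ) : ℕ :=
  Nat.nth Nat.Prime b.unpair.1 ^ cycleExp b.unpair.1 b.unpair.2

theorem primrec_cycleExp : Primrec₂ cycleExp := by
  have h : PrimrecRel fun (a : ℕ × ℕ) (x : ℕ) =>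
      ((Denumerable.ofNat Nat.Partrec.Code a.1).evaln a.2 x).isSome = true :=
    Primrec.eq.comp (Primrec.option_isSome.comp (Nat.Partrec.Code.primrec_evaln.comp
      (((Primrec.snd.comp Primrec.fst).pair
        ((Primrec.ofNat _).comp (Primrec.fst.comp Primrec.fst))).pair Primrec.snd)))
      (Primrec.const true)
  exact Primrec.nat_add.comp (Primrec.const 1) (Primrec.nat_findGreatest Primrec.snd h)

theorem primrec_cycleLen : Primrec cycleLen :=
  primrec_pow.comp (primrec_nth_prime.comp (Primrec.fst.comp Primrec.unpair))
    (primrec_cycleExp.comp (Primrec.fst.comp Primrec.unpair) (Primrec.snd.comp Primrec.unpair))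

theorem cycleExp_pos (n s : ℕ) : 0 < cycleExp n s := by
  unfold cycleExp; omega

theorem cycleLen_pair (n s : ℕ) :
    cycleLen (Nat.pair n s) = Nat.nth Nat.Prime n ^ cycleExp n s := by
  simp [cycleLen]

theorem cycleLen_pos (b : ℕ) : 0 < cycleLen b :=
  pow_pos (Nat.prime_nth_prime _).pos _

/-- `evaln k` succeeds only on inputs below `k`, so cutting the search off at the number of steps
loses no element of `W n`. -/
theorem mem_finSet_iff_bounded (n : ℕ) : n ∈ finSet ↔ ∃ C, ∀ s, cycleExp n s ≤ C := by
  have hW : ∀ x, x ∈ W n ↔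
      ∃ k, ((Denumerable.ofNat Nat.Partrec.Code n).evaln k x).isSome = true := by
    intro x
    simp only [W, Set.mem_ofPred_eq, Part.dom_iff_mem, Nat.Partrec.Code.evaln_complete,
      Option.isSome_iff_exists, Option.mem_def]
    exact exists_comm
  constructor
  · intro h
    obtain ⟨C, hC⟩ := Set.Finite.bddAbove (s := W n) h
    refine ⟨1 + C, fun s => Nat.add_le_add_left ?_ 1⟩
    -- The value `0` may be the default of an empty search, so it need not lie in `W n`.
    by_cases h0 : Nat.findGreatest
        (fun x => ((Denumerable.ofNat Nat.Partrec.Code n).evaln s x).isSome = true) s = 0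
    · rw [h0]; exact Nat.zero_le _
    · exact hC ((hW _).2 ⟨s, Nat.findGreatest_of_ne_zero rfl h0⟩)
  · rintro ⟨C, hC⟩
    refine (Set.finite_Iic C).subset fun x hx => ?_
    obtain ⟨k, hk⟩ := (hW x).1 hx
    obtain ⟨y, hy⟩ := Option.isSome_iff_exists.1 hk
    have hlt : x < k := Nat.Partrec.Code.evaln_bound hy
    have := Nat.le_findGreatest (P := fun x =>
      ((Denumerable.ofNat Nat.Partrec.Code n).evaln k x).isSome = true) hlt.le hk
    have h2 := hC k
    unfold cycleExp at h2
    simp only [Set.mem_Iic]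
    omega

end Primrec

end PermTree

/-! ### The procyclic group and its embedding into `S_∞`. -/

namespace PermTree

/-- The length of the cycle that contains `i`. -/
@[irreducible]
noncomputable def period (i : ℕ) : ℕ :=
  if i.unpair.2 < cycleLen i.unpair.1 then cycleLen i.unpair.1 else 1

/-- The `k`-th power of the permutation that moves `⟨b, r⟩` to `⟨b, r + 1 mod cycleLen b⟩` for
`r < cycleLen b` and fixes all other numbers. -/
@[irreducible]
noncomputable def rot (k : ℤ) (i : ℕ) : ℕ :=
  if i.unpair.2 < cycleLen i.unpair.1 then
    Nat.pair i.unpair.1 (((i.unpair.2 : ℤ) + k) % (cycleLen i.unpair.1 : ℤ)).toNat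
  else i

theorem period_pos (i : ℕ) : 0 < period i := by
  unfold period
  split_ifs
  · exact cycleLen_pos _
  · exact one_pos

instance (i : ℕ) : NeZero (period i) := ⟨(period_pos i).ne'⟩

theorem toNat_emod_lt (a : ℤ) {n : ℕ} (hn : 0 < n) : (a % (n : ℤ)).toNat < n := by
  have h1 := Int.emod_nonneg a (b := (n : ℤ)) (by omega)
  have h2 := Int.emod_lt_of_pos a (b := (n : ℤ)) (by omega)
  omega

theorem natCast_toNat_emod (a : ℤ) {n : ℕ} (hn : 0 < n) :
    (((a % (n : ℤ)).toNat : ℕ) : ℤ) = a % (n : ℤ) :=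
  Int.toNat_of_nonneg (Int.emod_nonneg a (by omega))

theorem rot_add (k l : ℤ) (i : ℕ) : rot (k + l) i = rot k (rot l i) := by
  by_cases h : i.unpair.2 < cycleLen i.unpair.1
  · have hp := cycleLen_pos i.unpair.1
    simp only [rot, if_pos h, Nat.unpair_pair, toNat_emod_lt _ hp, if_true,
      natCast_toNat_emod _ hp, Int.emod_add_emod]
    congr 3
    ring
  · simp only [rot, if_neg h]

theorem rot_zero (i : ℕ) : rot 0 i = i := by
  by_cases h : i.unpair.2 < cycleLen i.unpair.1
  · have : ((i.unpair.2 : ℤ) + 0) % (cycleLen i.unpair.1 : ℤ) = i.unpair.2 := by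
      rw [add_zero]
      exact Int.emod_eq_of_lt (by omega) (by omega)
    simp only [rot, if_pos h, this, Int.toNat_natCast, Nat.pair_unpair]
  · simp only [rot, if_neg h]

/-- Fixed points have period `1` and `ZMod 1` is trivial, so cycles and fixed points obey the same
rule. -/
theorem rot_eq_iff (k l : ℤ) (i : ℕ) :
    rot k i = rot l i ↔ (k : ZMod (period i)) = (l : ZMod (period i)) := by
  rw [ZMod.intCast_eq_intCast_iff]
  by_cases h : i.unpair.2 < cycleLen i.unpair.1
  · have hp := cycleLen_pos i.unpair.1
    simp only [rot, period, if_pos h, Nat.pair_eq_pair, true_and]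
    rw [← Int.natCast_inj, natCast_toNat_emod _ hp, natCast_toNat_emod _ hp]
    exact ⟨fun e => Int.ModEq.add_left_cancel' _ e, fun e => Int.ModEq.add_left _ e⟩
  · simp only [rot, period, if_neg h, Nat.cast_one, Int.modEq_one]

theorem rot_eq_self_iff (k : ℤ) (i : ℕ) : rot k i = i ↔ (k : ZMod (period i)) = 0 := by
  conv_lhs => rhs; rw [← rot_zero i]
  rw [rot_eq_iff, Int.cast_zero]

/-- `rot k` as a permutation. -/
noncomputable def rotPerm (k : ℤ) : Equiv.Perm ℕ where
  toFun := rot k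
  invFun := rot (-k)
  left_inv i := by rw [← rot_add, neg_add_cancel, rot_zero]
  right_inv i := by rw [← rot_add, add_neg_cancel, rot_zero]

/-- `x` agrees with the integer `k` in the first `m` coordinates. -/
def Agree (m : ℕ) (x : ∀ i, Multiplicative (ZMod (period i))) (k : ℤ) : Prop :=
  ∀ i < m, x i = Multiplicative.ofAdd (k : ZMod (period i))

theorem Agree.one (m : ℕ) : Agree m 1 0 := fun i _ => by simp

theorem Agree.mul {m : ℕ} {x y : ∀ i, Multiplicative (ZMod (period i))} {k l : ℤ}
    (hx : Agree m x k) (hy : Agree m y l) : Agree m (x * y) (k + l) := fun i hi => by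
  rw [Pi.mul_apply, hx i hi, hy i hi, ← ofAdd_add, Int.cast_add]

theorem Agree.inv {m : ℕ} {x : ∀ i, Multiplicative (ZMod (period i))} {k : ℤ}
    (hx : Agree m x k) : Agree m x⁻¹ (-k) := fun i hi => by
  rw [Pi.inv_apply, hx i hi, ← ofAdd_neg, Int.cast_neg]

theorem Agree.mono {m m' : ℕ} (h : m' ≤ m) {x : ∀ i, Multiplicative (ZMod (period i))} {k : ℤ}
    (hx : Agree m x k) : Agree m' x k := fun i hi => hx i (hi.trans_le h)

/-- The closure of the diagonal copy of `ℤ` in the product of the groups `ℤ / period i`. -/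
noncomputable def procyclic : Subgroup (∀ i, Multiplicative (ZMod (period i))) where
  carrier := {x | ∀ m, ∃ k, Agree m x k}
  one_mem' m := ⟨0, Agree.one m⟩
  mul_mem' hx hy m :=
    let ⟨_, hk⟩ := hx m
    let ⟨_, hl⟩ := hy m
    ⟨_, hk.mul hl⟩
  inv_mem' hx m :=
    let ⟨_, hk⟩ := hx m
    ⟨_, hk.inv⟩

/-- Each defining condition depends on finitely many discrete coordinates only. -/
theorem isClosed_procyclic :
    IsClosed (procyclic : Set (∀ i, Multiplicative (ZMod (period i)))) := by
  have : (procyclic : Set (∀ i, Multiplicative (ZMod (period i)))) =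
      ⋂ m, {x | ∃ k, Agree m x k} := by
    ext x
    simp only [Set.mem_iInter]
    rfl
  rw [this]
  refine isClosed_iInter fun m => ?_
  let r : (∀ i, Multiplicative (ZMod (period i))) →
      (∀ i : Fin m, Multiplicative (ZMod (period i))) := fun x i => x i
  have hr : Continuous r := continuous_pi fun i => continuous_apply _
  have hset : {x | ∃ k, Agree m x k} =
      r ⁻¹' {y | ∃ k : ℤ, ∀ i : Fin m, y i = Multiplicative.ofAdd (k : ZMod (period i))} := by
    ext x
    exact exists_congr fun k => ⟨fun h i => h i i.2, fun h i hi => h ⟨i, hi⟩⟩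
  rw [hset]
  exact (isClosed_discrete _).preimage hr

instance (i : ℕ) : Finite (Multiplicative (ZMod (period i))) :=
  inferInstanceAs (Finite (ZMod (period i)))

instance : CompactSpace procyclic :=
  isCompact_iff_compactSpace.1 isClosed_procyclic.isCompact

/-- The action of an element of `procyclic` on `ℕ`. -/
@[irreducible]
noncomputable def act (x : procyclic) (i : ℕ) : ℕ :=
  rot (((x.1 i).toAdd.val : ℕ) : ℤ) i

theorem Agree.act_eq {m : ℕ} {x : procyclic} {k : ℤ} (h : Agree m x.1 k) {i : ℕ} (hi : i < m) :
    act x i = rot k i := by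
  rw [act, rot_eq_iff, h i hi, toAdd_ofAdd, Int.cast_natCast, ZMod.natCast_zmod_val]

theorem act_one (i : ℕ) : act 1 i = i := by
  have h : Agree (i + 1) (1 : procyclic).1 0 := Agree.one (i + 1)
  rw [h.act_eq (Nat.lt_succ_self i), rot_zero]

theorem act_mul (x y : procyclic) (i : ℕ) : act (x * y) i = act x (act y i) := by
  obtain ⟨l, hl⟩ := y.2 (i + 1)
  -- `x` acts on the image of `i` through another coordinate than `i`. The level has to exceed both,
  -- and `l` serves only to locate the image.
  obtain ⟨k, hk⟩ := x.2 (max (i + 1) (rot l i + 1))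
  obtain ⟨l', hl'⟩ := y.2 (max (i + 1) (rot l i + 1))
  have hi : i < max (i + 1) (rot l i + 1) := by omega
  have e : act y i = rot l i := hl.act_eq (Nat.lt_succ_self i)
  have e' : act y i = rot l' i := hl'.act_eq hi
  have hxy : Agree (max (i + 1) (rot l i + 1)) (x * y).1 (k + l') := hk.mul hl'
  rw [e, hk.act_eq (by omega : rot l i < max (i + 1) (rot l i + 1)), ← e, e', ← rot_add,
    hxy.act_eq hi]

/-- `procyclic` as a group of permutations of `ℕ`. -/
noncomputable def actHom : procyclic →* Equiv.Perm ℕ where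
  toFun x :=
    { toFun := act x
      invFun := act x⁻¹
      left_inv := fun i => by rw [← act_mul, inv_mul_cancel, act_one]
      right_inv := fun i => by rw [← act_mul, mul_inv_cancel, act_one] }
  map_one' := Equiv.ext act_one
  map_mul' x y := Equiv.ext (act_mul x y)

theorem actHom_apply (x : procyclic) (i : ℕ) : actHom x i = act x i := rfl

theorem Agree.path_eq {m : ℕ} {x : procyclic} {k : ℤ} (h : Agree m x.1 k) {j : ℕ}
    (hj : j < 2 * m) : path (actHom x) j = path (rotPerm k) j := by
  unfold path
  split_ifs
  · exact h.act_eq (by omega)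
  · rw [← map_inv]
    have h' : Agree m (x⁻¹ : procyclic).1 (-k) := h.inv
    exact h'.act_eq (by omega)

theorem actHom_injective : Function.Injective actHom := by
  refine (injective_iff_map_eq_one _).2 fun x hx => ?_
  ext i
  obtain ⟨k, hk⟩ := x.2 (i + 1)
  have h1 : act x i = i := by rw [← actHom_apply, hx]; rfl
  rw [hk.act_eq (Nat.lt_succ_self i), rot_eq_self_iff] at h1
  rw [hk i (Nat.lt_succ_self i), h1]
  rfl

/-- The image of `procyclic` in `S_∞`, the closure of the subgroup generated by `rotPerm 1`. -/
noncomputable def cycleGroup : Subgroup (Equiv.Perm ℕ) := actHom.range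

/-- `cycleGroup` is a copy of `procyclic`. -/
noncomputable def cycleGroupEquiv : procyclic ≃* cycleGroup :=
  MonoidHom.ofInjective actHom_injective

theorem path_injective : Function.Injective path := fun g h e => by
  ext i
  have := congrFun e (2 * i)
  simpa [path] using this

theorem continuous_cycleGroupEquiv : Continuous cycleGroupEquiv := by
  refine Continuous.subtype_mk (f := fun x => actHom x) ?_ _
  refine continuous_induced_rng.2 (continuous_pi fun j => ?_)
  have hcoord : ∀ i, Continuous fun x : procyclic => act x i := fun i => by
    let f : Multiplicative (ZMod (period i)) → ℕ := fun z => rot ((z.toAdd.val : ℕ) : ℤ) i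
    have hf : Continuous f := continuous_of_discreteTopology
    refine (hf.comp ((continuous_apply i).comp continuous_subtype_val)).congr fun x => ?_
    rw [act]
    rfl
  by_cases hj : Even j
  · refine (hcoord (j / 2)).congr fun x => ?_
    simp only [Function.comp_apply, path, if_pos hj, actHom_apply]
  · refine ((hcoord (j / 2)).comp continuous_inv).congr fun x => ?_
    simp only [Function.comp_apply, path, if_neg hj, ← map_inv, actHom_apply]

/-- A continuous bijection from a compact space to a Hausdorff space is a homeomorphism. -/
theorem isProfiniteSubgroup_cycleGroup : IsProfiniteSubgroup cycleGroup := by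
  have : T2Space (Equiv.Perm ℕ) :=
    T2Space.of_injective_continuous path_injective continuous_induced_dom
  let e := Continuous.homeoOfEquivCompactToT2 (f := cycleGroupEquiv.toEquiv)
    continuous_cycleGroupEquiv
  exact ⟨ProfiniteGrp.of procyclic,
    ⟨{ cycleGroupEquiv.symm with
        continuous_toFun := e.symm.continuous
        continuous_invFun := e.continuous }⟩⟩

end PermTree

/-! ### Computability of the tree. -/

namespace PermTree

/-- The least common multiple of the first `m` periods. -/
noncomputable def periodLcm (m : ℕ) : ℕ :=
  Nat.rec 1 (fun i l => Nat.lcm l (period i)) m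

theorem periodLcm_succ (m : ℕ) : periodLcm (m + 1) = Nat.lcm (periodLcm m) (period m) := rfl

theorem periodLcm_pos (m : ℕ) : 0 < periodLcm m := by
  induction m with
  | zero => exact one_pos
  | succ m ih => exact Nat.lcm_pos ih (period_pos m)

theorem periodLcm_dvd_iff (m d : ℕ) : periodLcm m ∣ d ↔ ∀ i < m, period i ∣ d := by
  induction m with
  | zero => simp [periodLcm]
  | succ m ih => rw [periodLcm_succ, Nat.lcm_dvd_iff, ih, Nat.forall_lt_succ_right]

theorem modEq_periodLcm_iff (m : ℕ) (k l : ℤ) :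
    k ≡ l [ZMOD periodLcm m] ↔
      ∀ i < m, (k : ZMod (period i)) = (l : ZMod (period i)) := by
  simp only [ZMod.intCast_eq_intCast_iff, Int.modEq_iff_dvd, Int.natCast_dvd, periodLcm_dvd_iff]

theorem primrec_period : Primrec period := by
  have hb : Primrec fun i : ℕ => cycleLen i.unpair.1 :=
    primrec_cycleLen.comp (Primrec.fst.comp Primrec.unpair)
  refine (Primrec.ite (Primrec.nat_lt.comp (Primrec.snd.comp Primrec.unpair) hb) hb
    (Primrec.const 1)).of_eq fun i => ?_
  rw [period]

theorem primrec_periodLcm : Primrec periodLcm :=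
  Primrec.nat_rec₁ 1 (primrec_lcm.comp (Primrec.snd)
    (primrec_period.comp (Primrec.fst)))

/-- The finite sequence `g(0) g⁻¹(0) ⋯ g(n - 1) g⁻¹(n - 1)` for `g = rotPerm k`. -/
noncomputable def rotWord (k : ℤ) (n : ℕ) : List ℕ := (List.range (2 * n)).map (path (rotPerm k))

theorem length_rotWord (k : ℤ) (n : ℕ) : (rotWord k n).length = 2 * n := by simp [rotWord]

theorem path_rotPerm (k : ℤ) (j : ℕ) :
    path (rotPerm k) j = if Even j then rot k (j / 2) else rot (-k) (j / 2) := rfl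

/-- Values of the inverse impose the same congruences as values of the permutation, so the words of
this length correspond to residues modulo `periodLcm n`. -/
theorem rotWord_eq_iff (k l : ℤ) (n : ℕ) :
    rotWord k n = rotWord l n ↔ k ≡ l [ZMOD periodLcm n] := by
  rw [modEq_periodLcm_iff]
  simp only [rotWord, List.map_inj_left, List.mem_range, path_rotPerm]
  constructor
  · intro h i hi
    have := h (2 * i) (by omega)
    simpa [rot_eq_iff] using this
  · intro h j hj
    have := h (j / 2) (by omega)
    split_ifs
    · exact (rot_eq_iff _ _ _).2 this
    · refine (rot_eq_iff _ _ _).2 ?_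
      rw [Int.cast_neg, Int.cast_neg, this]

theorem rotWord_prefix (k : ℤ) {n n' : ℕ} (h : n ≤ n') : rotWord k n <+: rotWord k n' := by
  have : List.range (2 * n) <+: List.range (2 * n') := by
    rw [List.prefix_iff_eq_take]
    simp [List.take_range, h]
  exact this.map _

theorem rotWord_prefix_iff (k l : ℤ) {n n' : ℕ} :
    rotWord k n <+: rotWord l n' ↔ n ≤ n' ∧ k ≡ l [ZMOD periodLcm n] := by
  rw [← rotWord_eq_iff]
  constructor
  · intro h
    have hle : n ≤ n' := by simpa [length_rotWord] using h.length_le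
    exact ⟨hle, (List.prefix_of_prefix_length_le h (rotWord_prefix l hle)
      (by simp [length_rotWord])).eq_of_length (by simp [length_rotWord])⟩
  · rintro ⟨hle, h⟩
    rw [h]
    exact rotWord_prefix l hle

/-- The element of `procyclic` given by an integer. -/
noncomputable def diag (k : ℤ) : procyclic :=
  ⟨fun i => Multiplicative.ofAdd (k : ZMod (period i)), fun _ => ⟨k, fun _ _ => rfl⟩⟩

theorem agree_diag (m : ℕ) (k : ℤ) : Agree m (diag k).1 k := fun _ _ => rfl

/-- Passing to the closure adds no finite words: the dense cyclic subgroup already has the whole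
tree. -/
theorem mem_tree_iff (τ : List ℕ) :
    τ ∈ tree cycleGroup ↔ ∃ k : ℤ, ∃ n, τ = rotWord k (n + 1) := by
  constructor
  · rintro ⟨_, ⟨x, rfl⟩, n, rfl⟩
    obtain ⟨k, hk⟩ := x.2 (n + 1)
    exact ⟨k, n, List.map_congr_left fun j hj => hk.path_eq (List.mem_range.1 hj)⟩
  · rintro ⟨k, n, rfl⟩
    exact ⟨actHom (diag k), ⟨_, rfl⟩, n, List.map_congr_left fun j hj =>
      ((agree_diag (n + 1) k).path_eq (List.mem_range.1 hj)).symm⟩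

/-- All nodes have even length, so a direct successor is two entries longer. -/
theorem mem_directSuccessors_iff (k : ℤ) (n : ℕ) (σ : List ℕ) :
    σ ∈ directSuccessors (tree cycleGroup) (rotWord k (n + 1)) ↔
      ∃ l : ℤ, k ≡ l [ZMOD periodLcm (n + 1)] ∧ σ = rotWord l (n + 2) := by
  constructor
  · rintro ⟨hσ, hpre, hne, hmin⟩
    obtain ⟨l, n', rfl⟩ := (mem_tree_iff σ).1 hσ
    obtain ⟨hle, hkl⟩ := (rotWord_prefix_iff _ _).1 hpre
    rcases hle.eq_or_lt with heq | hlt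
    · rw [← heq] at hne
      exact absurd ((rotWord_eq_iff _ _ _).2 hkl) hne
    · refine ⟨l, hkl, ?_⟩
      rcases hmin (rotWord l (n + 2)) ((mem_tree_iff _).2 ⟨l, n + 1, rfl⟩)
        ((rotWord_prefix_iff _ _).2 ⟨by omega, hkl⟩) (rotWord_prefix l (by omega)) with h | h
      · have := congrArg List.length h
        simp only [length_rotWord] at this
        omega
      · exact h.symm
  · rintro ⟨l, hkl, rfl⟩
    refine ⟨(mem_tree_iff _).2 ⟨l, n + 1, rfl⟩, (rotWord_prefix_iff _ _).2 ⟨by omega, hkl⟩,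
      fun h => ?_, fun ρ hρ h1 h2 => ?_⟩
    · have := congrArg List.length h
      simp only [length_rotWord] at this
      omega
    · obtain ⟨l', n', rfl⟩ := (mem_tree_iff ρ).1 hρ
      have hn1 := ((rotWord_prefix_iff _ _).1 h1).1
      have hn2 := ((rotWord_prefix_iff _ _).1 h2).1
      rcases (by omega : n' = n ∨ n' = n + 1) with rfl | rfl
      · exact Or.inl (h1.eq_of_length (by simp [length_rotWord])).symm
      · exact Or.inr (h2.eq_of_length (by simp [length_rotWord]))

/-- Successors are the lifts of a residue modulo `periodLcm (n + 1)` to residues modulo `periodLcm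
(n + 2)`. -/
theorem encard_directSuccessors (k : ℤ) (n : ℕ) :
    (directSuccessors (tree cycleGroup) (rotWord k (n + 1))).encard =
      ((periodLcm (n + 2) / periodLcm (n + 1) : ℕ) : ℕ∞) := by
  obtain ⟨d, hd⟩ : periodLcm (n + 1) ∣ periodLcm (n + 2) := Nat.dvd_lcm_left _ _
  have hA := periodLcm_pos (n + 1)
  have hd0 : 0 < d := by
    rcases Nat.eq_zero_or_pos d with rfl | h
    · exact absurd hd (periodLcm_pos (n + 2)).ne'
    · exact h
  rw [hd, Nat.mul_div_cancel_left _ hA]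
  -- The lifts of `k` are `k + periodLcm (n + 1) * j`, and `j` counts modulo the quotient `d`.
  let f : ℕ → List ℕ := fun j => rotWord (k + periodLcm (n + 1) * (j : ℤ)) (n + 2)
  have hf : ∀ s t : ℤ, rotWord (k + periodLcm (n + 1) * s) (n + 2) =
      rotWord (k + periodLcm (n + 1) * t) (n + 2) ↔ s ≡ t [ZMOD d] := by
    intro s t
    rw [rotWord_eq_iff, hd, Nat.cast_mul]
    constructor
    · intro h
      exact Int.ModEq.mul_left_cancel' (by exact_mod_cast hA.ne') (Int.ModEq.add_left_cancel' _ h)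
    · intro h
      exact Int.ModEq.add_left _ h.mul_left'
  have himage : directSuccessors (tree cycleGroup) (rotWord k (n + 1)) =
      f '' (Finset.range d : Set ℕ) := by
    ext σ
    rw [mem_directSuccessors_iff]
    constructor
    · rintro ⟨l, hkl, rfl⟩
      obtain ⟨t, ht⟩ := hkl.dvd
      refine ⟨(t % (d : ℤ)).toNat, by simpa using toNat_emod_lt t hd0, ?_⟩
      have : l = k + periodLcm (n + 1) * t := by rw [← ht]; ring
      rw [this]
      refine (hf _ _).2 ?_
      rw [natCast_toNat_emod _ hd0]
      exact Int.mod_modEq _ _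
    · rintro ⟨j, -, rfl⟩
      refine ⟨_, ?_, rfl⟩
      rw [Int.modEq_iff_dvd]
      exact ⟨j, by ring⟩
  have hinj : Set.InjOn f (Finset.range d : Set ℕ) := by
    intro i hi j hj hij
    have := Int.natCast_modEq_iff.1 ((hf i j).1 hij)
    exact Nat.ModEq.eq_of_lt_of_lt this (by simpa using hi) (by simpa using hj)
  rw [himage, hinj.encard_image, Set.encard_coe_eq_coe_finsetCard, Finset.card_range]

/-- `rot` for natural numbers, in a form that is visibly primitive recursive. -/
noncomputable def natRot (k i : ℕ) : ℕ :=
  if i.unpair.2 < cycleLen i.unpair.1 then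
    Nat.pair i.unpair.1 ((i.unpair.2 + k) % cycleLen i.unpair.1)
  else i

theorem rot_natCast (k i : ℕ) : rot k i = natRot k i := by
  rw [rot, natRot, ← Nat.cast_add, ← Int.natCast_mod, Int.toNat_natCast]

/-- `period i * k - k` is a natural number congruent to `-k`, which keeps the inverse within
primitive recursion on `ℕ`. -/
theorem rot_neg_natCast (k i : ℕ) : rot (-k) i = natRot (period i * k - k) i := by
  rw [← rot_natCast, rot_eq_iff,
    Nat.cast_sub (Nat.le_mul_of_pos_left _ (period_pos i))]
  simp

theorem primrec_natRot : Primrec₂ natRot := by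
  have hu : Primrec fun a : ℕ × ℕ => a.2.unpair := Primrec.unpair.comp Primrec.snd
  have hb : Primrec fun a : ℕ × ℕ => cycleLen a.2.unpair.1 :=
    primrec_cycleLen.comp (Primrec.fst.comp hu)
  exact Primrec.ite (Primrec.nat_lt.comp (Primrec.snd.comp hu) hb)
    (Primrec₂.natPair.comp (Primrec.fst.comp hu)
      (Primrec.nat_mod.comp (Primrec.nat_add.comp (Primrec.snd.comp hu) Primrec.fst) hb))
    Primrec.snd

theorem primrec_rotWord : Primrec₂ fun k n : ℕ => rotWord k n := by
  have hhalf : Primrec fun a : (ℕ × ℕ) × ℕ => a.2 / 2 :=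
    Primrec.nat_div.comp Primrec.snd (Primrec.const 2)
  have hk : Primrec fun a : (ℕ × ℕ) × ℕ => a.1.1 := Primrec.fst.comp Primrec.fst
  have hpath : Primrec₂ fun (a : ℕ × ℕ) (j : ℕ) =>
      if j % 2 = 0 then natRot a.1 (j / 2)
      else natRot (period (j / 2) * a.1 - a.1) (j / 2) :=
    Primrec.ite
      (Primrec.eq.comp (Primrec.nat_mod.comp Primrec.snd (Primrec.const 2)) (Primrec.const 0))
      (primrec_natRot.comp hk hhalf)
      (primrec_natRot.comp (Primrec.nat_sub.comp
        (Primrec.nat_mul.comp (primrec_period.comp hhalf) hk) hk) hhalf)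
  refine (Primrec.list_map (Primrec.list_range.comp
    (Primrec.nat_mul.comp (Primrec.const 2) Primrec.snd)) hpath).of_eq fun a => ?_
  refine List.map_congr_left fun j _ => ?_
  simp only [path_rotPerm, Nat.even_iff, rot_natCast, rot_neg_natCast]

/-- Reducing the exponent modulo `periodLcm` bounds the search. The length condition excludes the
empty word; odd lengths are excluded by the equation itself. -/
theorem mem_tree_iff_bounded (τ : List ℕ) :
    τ ∈ tree cycleGroup ↔ 2 ≤ τ.length ∧
      ∃ k ∈ List.range (periodLcm (τ.length / 2)), τ = rotWord (k : ℕ) (τ.length / 2) := by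
  rw [mem_tree_iff]
  constructor
  · rintro ⟨k, n, rfl⟩
    have hlen : (rotWord k (n + 1)).length / 2 = n + 1 := by rw [length_rotWord]; omega
    have hpos := periodLcm_pos (n + 1)
    rw [hlen]
    refine ⟨by rw [length_rotWord]; omega, (k % (periodLcm (n + 1) : ℤ)).toNat,
      List.mem_range.2 (toNat_emod_lt k hpos), ?_⟩
    rw [rotWord_eq_iff, natCast_toNat_emod _ hpos]
    exact (Int.mod_modEq _ _).symm
  · rintro ⟨h2, k, -, hk⟩
    obtain ⟨n, hn⟩ : ∃ n, τ.length / 2 = n + 1 := ⟨τ.length / 2 - 1, by omega⟩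
    exact ⟨k, n, by rw [← hn]; exact hk⟩

theorem isComputableTree_cycleGroup : IsComputableTree (tree cycleGroup) := by
  have hhalf : Primrec fun τ : List ℕ => τ.length / 2 :=
    Primrec.nat_div.comp Primrec.list_length (Primrec.const 2)
  constructor
  · have hrel : PrimrecRel fun (k : ℕ) (τ : List ℕ) => τ = rotWord k (τ.length / 2) :=
      Primrec.eq.comp Primrec.snd (primrec_rotWord.comp Primrec.fst (hhalf.comp Primrec.snd))
    have h : PrimrecPred fun τ : List ℕ => 2 ≤ τ.length ∧
        ∃ k ∈ List.range (periodLcm (τ.length / 2)), τ = rotWord (k : ℕ) (τ.length / 2) :=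
      PrimrecPred.and (Primrec.nat_le.comp (Primrec.const 2) Primrec.list_length)
        (hrel.exists_mem_list.comp (Primrec.list_range.comp (primrec_periodLcm.comp hhalf))
          Primrec.id)
    exact (h.of_eq fun τ => (mem_tree_iff_bounded τ).symm).computablePred
  · refine ⟨fun τ => some (periodLcm (τ.length / 2 + 1) / periodLcm (τ.length / 2)),
      (Primrec.option_some.comp (Primrec.nat_div.comp
        (primrec_periodLcm.comp (Primrec.succ.comp hhalf))
        (primrec_periodLcm.comp hhalf))).to_comp, fun τ hτ => ?_⟩
    obtain ⟨k, n, rfl⟩ := (mem_tree_iff τ).1 hτ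
    have hlen : (rotWord k (n + 1)).length / 2 = n + 1 := by rw [length_rotWord]; omega
    beta_reduce
    rw [hlen, encard_directSuccessors]
    rfl

end PermTree

/-! ### Torsion, and failure of orbit independence. -/

namespace PermTree

theorem realize_powTerm {H : Type*} [Group H] {n : ℕ} (t : groupLanguage.Term (Empty ⊕ Fin n))
    (v : Empty ⊕ Fin n → H) (k : ℕ) :
    (powTerm t k).realize v = t.realize v ^ k := by
  induction k with
  | zero => rw [pow_zero]; rfl
  | succ k ih => rw [pow_succ, ← ih]; rfl

theorem realize_torsionSentence {H : Type*} [Group H] (p : ℕ) :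
    H ⊨ torsionSentence p ↔ ∃ x : H, x ≠ 1 ∧ x ^ p = 1 := by
  simp only [torsionSentence, Language.Sentence.Realize, Language.Formula.Realize,
    Language.BoundedFormula.realize_ex, Language.BoundedFormula.realize_inf,
    Language.BoundedFormula.realize_not, Language.BoundedFormula.realize_bdEqual,
    realize_powTerm, pow_zero]
  rfl

theorem period_eq_or (n i : ℕ) :
    Nat.Coprime (period i) (Nat.nth Nat.Prime n) ∨
      ∃ s, period i = Nat.nth Nat.Prime n ^ cycleExp n s := by
  rw [period]
  split_ifs
  · rw [cycleLen]
    by_cases h : i.unpair.1.unpair.1 = n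
    · exact Or.inr ⟨i.unpair.1.unpair.2, by rw [h]⟩
    · refine Or.inl (Nat.Coprime.pow_left _ ?_)
      rw [Nat.coprime_primes (Nat.prime_nth_prime _) (Nat.prime_nth_prime _)]
      exact fun e => h (Nat.nth_injective Nat.infinite_setOfPred_prime e)
  · exact Or.inl (Nat.coprime_one_left _)

theorem period_pair (n s : ℕ) :
    period (Nat.pair (Nat.pair n s) 0) = Nat.nth Nat.Prime n ^ cycleExp n s := by
  rw [period, Nat.unpair_pair, if_pos (cycleLen_pos _), cycleLen_pair]

theorem Agree.pow {m : ℕ} {x : ∀ i, Multiplicative (ZMod (period i))} {k : ℤ}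
    (hx : Agree m x k) (p : ℕ) : Agree m (x ^ p) (p * k) := fun i hi => by
  rw [Pi.pow_apply, hx i hi, ← ofAdd_nsmul, nsmul_eq_mul, Int.cast_mul, Int.cast_natCast]

theorem Agree.dvd_of_eq_one {m : ℕ} {k : ℤ} (h : Agree m 1 k) {i : ℕ} (hi : i < m) :
    (period i : ℤ) ∣ k := by
  rw [← ZMod.intCast_zmod_eq_zero_iff_dvd]
  exact (Multiplicative.ofAdd.injective (h i hi)).symm

/-- The exponents of `p` are unbounded, so a coordinate of period `p ^ e` is controlled by another
whose period is a higher power of `p`: being killed by `p` there forces divisibility by `p ^ e`. If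
`p` does not divide the period, `p` is invertible in that coordinate. -/
theorem eq_one_of_pow_prime_eq_one {n : ℕ} (hn : n ∉ finSet) (x : procyclic)
    (hx : x ^ Nat.nth Nat.Prime n = 1) : x = 1 := by
  have hp := Nat.prime_nth_prime n
  have key : ∀ i, ∃ j, ∀ k : ℤ, (period j : ℤ) ∣ (Nat.nth Nat.Prime n : ℤ) * k →
      (period i : ℤ) ∣ k := by
    intro i
    rcases period_eq_or n i with h | ⟨s, hs⟩
    · exact ⟨i, fun k hk => Int.dvd_of_dvd_mul_right_of_gcd_one hk h⟩
    · rw [mem_finSet_iff_bounded] at hn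
      push Not at hn
      obtain ⟨s', hs'⟩ := hn (cycleExp n s)
      refine ⟨Nat.pair (Nat.pair n s') 0, fun k hk => ?_⟩
      rw [period_pair] at hk
      rw [hs]
      have h1 : (Nat.nth Nat.Prime n : ℤ) * ((Nat.nth Nat.Prime n ^ cycleExp n s : ℕ) : ℤ) ∣
          (Nat.nth Nat.Prime n : ℤ) * k := by
        refine dvd_trans ?_ hk
        rw [← Nat.cast_mul, ← pow_succ', Int.natCast_dvd_natCast]
        exact pow_dvd_pow _ hs'
      exact Int.dvd_of_mul_dvd_mul_left (by exact_mod_cast hp.ne_zero) h1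
  ext i
  obtain ⟨j, hj⟩ := key i
  obtain ⟨k, hk⟩ := x.2 (max i j + 1)
  have hpow := hk.pow (Nat.nth Nat.Prime n)
  have hx' : x.1 ^ Nat.nth Nat.Prime n = 1 := congrArg Subtype.val hx
  rw [hx'] at hpow
  have hdvd := hj k (hpow.dvd_of_eq_one (by omega))
  rw [hk i (by omega), (ZMod.intCast_zmod_eq_zero_iff_dvd _ _).2 hdvd]
  rfl

/-- With `c + 1` the largest exponent, the element is `p ^ c` on the coordinates whose period is
divisible by `p` and trivial elsewhere. A cycle attaining the largest exponent shows that it is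
nontrivial. -/
theorem exists_torsion_of_mem_finSet {n : ℕ} (hn : n ∈ finSet) :
    ∃ x : procyclic, x ≠ 1 ∧ x ^ Nat.nth Nat.Prime n = 1 := by
  have hp := Nat.prime_nth_prime n
  obtain ⟨C, hC⟩ := (mem_finSet_iff_bounded n).1 hn
  obtain ⟨s₀, hs₀⟩ : ∃ s₀, ∀ s, cycleExp n s ≤ cycleExp n s₀ := by
    have hbdd : BddAbove (Set.range (cycleExp n)) := ⟨C, by rintro _ ⟨s, rfl⟩; exact hC s⟩
    obtain ⟨s₀, h⟩ := Nat.sSup_mem (Set.range_nonempty (cycleExp n)) hbdd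
    exact ⟨s₀, fun s => h ▸ le_csSup hbdd ⟨s, rfl⟩⟩
  obtain ⟨c, hc⟩ : ∃ c, cycleExp n s₀ = c + 1 :=
    ⟨cycleExp n s₀ - 1, by have := cycleExp_pos n s₀; omega⟩
  set p := Nat.nth Nat.Prime n
  have hperiod : ∀ i, p ∣ period i → period i ∣ p ^ (c + 1) := fun i hi => by
    rcases period_eq_or n i with h | ⟨s, hs⟩
    · exact absurd ((Nat.Prime.coprime_iff_not_dvd hp).1 h.symm) (not_not.2 hi)
    · rw [hs, ← hc]
      exact pow_dvd_pow _ (hs₀ s)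
  let y : ∀ i, Multiplicative (ZMod (period i)) := fun i =>
    if p ∣ period i then Multiplicative.ofAdd (((p ^ c : ℕ) : ℤ) : ZMod (period i)) else 1
  have hy : y ∈ procyclic := by
    intro m
    -- The Chinese remainder theorem, for the coprime moduli `p ^ (c + 1)` and `N`, gives one
    -- integer matching `y` in the first `m` coordinates.
    let N := ∏ i ∈ (Finset.range m).filter (fun i => ¬ p ∣ period i), period i
    have hcop : Nat.Coprime (p ^ (c + 1)) N := by
      refine Nat.Coprime.pow_left _ (Nat.Coprime.prod_right fun i hi => ?_)
      exact (Nat.Prime.coprime_iff_not_dvd hp).2 (Finset.mem_filter.1 hi).2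
    obtain ⟨k, hk1, hk2⟩ := Nat.chineseRemainder hcop (p ^ c) 0
    refine ⟨k, fun i hi => ?_⟩
    by_cases h : p ∣ period i
    · simp only [y, if_pos h]
      congr 1
      rw [ZMod.intCast_eq_intCast_iff]
      exact Int.natCast_modEq_iff.2 (hk1.symm.of_dvd (hperiod i h))
    · simp only [y, if_neg h]
      have h1 : period i ∣ N := Finset.dvd_prod_of_mem _ (by simp [hi, h])
      have h2 : period i ∣ k := h1.trans ((Nat.modEq_zero_iff_dvd).1 hk2)
      rw [Int.cast_natCast, (ZMod.natCast_eq_zero_iff _ _).2 h2]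
      rfl
  refine ⟨⟨y, hy⟩, fun h => ?_, ?_⟩
  · have hi := congrFun (congrArg Subtype.val h) (Nat.pair (Nat.pair n s₀) 0)
    have hper : period (Nat.pair (Nat.pair n s₀) 0) = p ^ (c + 1) := by rw [period_pair, hc]
    have hdvd : p ∣ period (Nat.pair (Nat.pair n s₀) 0) := by
      rw [hper]; exact dvd_pow_self _ (Nat.succ_ne_zero c)
    simp only [y, if_pos hdvd] at hi
    have h0 : ((p ^ c : ℕ) : ZMod (period (Nat.pair (Nat.pair n s₀) 0))) = 0 := by
      have := Multiplicative.ofAdd.injective hi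
      rwa [Int.cast_natCast] at this
    rw [ZMod.natCast_eq_zero_iff, hper, Nat.pow_dvd_pow_iff_le_right hp.one_lt] at h0
    omega
  · ext i
    change y i ^ p = 1
    by_cases h : p ∣ period i
    · simp only [y, if_pos h]
      rw [← ofAdd_nsmul, nsmul_eq_mul, Int.cast_natCast, ← Nat.cast_mul, ← pow_succ',
        (ZMod.natCast_eq_zero_iff _ _).2 (hperiod i h)]
      rfl
    · simp only [y, if_neg h, one_pow]

theorem cycleGroup_torsion_iff (n : ℕ) :
    cycleGroup ⊨ torsionSentence (Nat.nth Nat.Prime n) ↔ n ∈ finSet := by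
  rw [realize_torsionSentence]
  constructor
  · rintro ⟨x, hx1, hx⟩
    by_contra hn
    refine hx1 (cycleGroupEquiv.symm.injective ?_)
    rw [map_one]
    exact eq_one_of_pow_prime_eq_one hn _ (by rw [← map_pow, hx, map_one])
  · intro hn
    obtain ⟨x, hx1, hx⟩ := exists_torsion_of_mem_finSet hn
    exact ⟨cycleGroupEquiv x, fun h => hx1 (cycleGroupEquiv.injective (h.trans (map_one _).symm)),
      by rw [← map_pow, hx, map_one]⟩

/-- A point outside all listed orbits would bound infinitely many distinct representatives. It also
keeps each set of candidates nonempty, so the default value of `sInf` plays no role. -/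
theorem exists_mem_orbitSet (G : Subgroup (Equiv.Perm ℕ)) (i : ℕ) : ∃ k, i ∈ orbitSet G k := by
  by_contra! h
  have hmem : ∀ k, i ∈ {x : ℕ | ∀ m : Fin k, x ∉ MulAction.orbit G (orbitRep G m)} :=
    fun k m => h m
  have hle : ∀ k, orbitRep G k ≤ i := fun k => by
    rw [orbitRep]
    exact Nat.sInf_le (hmem k)
  have hnot : ∀ k, ∀ m < k, orbitRep G k ≠ orbitRep G m := fun k m hm e => by
    have h1 := Nat.sInf_mem ⟨i, hmem k⟩
    rw [← orbitRep] at h1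
    exact h1 ⟨m, hm⟩ (e ▸ MulAction.mem_orbit_self _)
  have hinj : Function.Injective (orbitRep G) := fun a b e => by
    rcases lt_trichotomy a b with hab | hab | hab
    · exact absurd e.symm (hnot b a hab)
    · exact hab
    · exact absurd e (hnot a b hab)
  exact Set.infinite_range_of_injective hinj
    ((Set.finite_Iic i).subset (by rintro _ ⟨k, rfl⟩; exact hle k))

theorem exists_notMem_finSet : ∃ n, n ∉ finSet := by
  refine ⟨Encodable.encode Nat.Partrec.Code.zero, fun h => ?_⟩
  have hW : W (Encodable.encode Nat.Partrec.Code.zero) = Set.univ := by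
    ext x
    simp only [W, Denumerable.ofNat_encode, Set.mem_univ, iff_true]
    trivial
  change (W _).Finite at h
  rw [hW] at h
  exact Set.infinite_univ h

theorem cycleGroupEquiv_smul (x : procyclic) (i : ℕ) : cycleGroupEquiv x • i = act x i := rfl

/-- For `n ∉ Fin` the group has no `p_n`-torsion. The element `p ^ c`, restricted to the orbit of a
point on a cycle of length `p ^ (c + 1)`, has order `p`, and so has its extension by `1` to the
product of the `H_k`. -/
theorem not_orbitIndependent_cycleGroup : ¬ OrbitIndependent cycleGroup := by
  rintro ⟨e⟩
  obtain ⟨n, hn⟩ := exists_notMem_finSet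
  have hp := Nat.prime_nth_prime n
  set p := Nat.nth Nat.Prime n
  let i := Nat.pair (Nat.pair n 0) 0
  obtain ⟨c, hc⟩ : ∃ c, cycleExp n 0 = c + 1 :=
    ⟨cycleExp n 0 - 1, by have := cycleExp_pos n 0; omega⟩
  have hper : period i = p ^ (c + 1) := by rw [period_pair, hc]
  obtain ⟨k, hk⟩ := exists_mem_orbitSet cycleGroup i
  let x := diag ((p ^ c : ℕ) : ℤ)
  have hxi : act x i ≠ i := by
    rw [(agree_diag (i + 1) _).act_eq (Nat.lt_succ_self i), Ne, rot_eq_self_iff, Int.cast_natCast,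
      ZMod.natCast_eq_zero_iff, hper, Nat.pow_dvd_pow_iff_le_right hp.one_lt]
    omega
  have hxpi : act (x ^ p) i = i := by
    have h : Agree (i + 1) (x ^ p).1 (p * ((p ^ c : ℕ) : ℤ)) := (agree_diag (i + 1) _).pow p
    rw [h.act_eq (Nat.lt_succ_self i), rot_eq_self_iff, ← Nat.cast_mul, ← pow_succ',
      Int.cast_natCast, ZMod.natCast_eq_zero_iff, hper]
  let h : orbitGroup cycleGroup k := ⟨_, ⟨cycleGroupEquiv x, rfl⟩⟩
  have h1 : h ≠ 1 := fun e1 => by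
    have := congrArg (fun f : orbitGroup cycleGroup k =>
      ((f.1 ⟨i, hk⟩ : orbitSet cycleGroup k) : ℕ)) e1
    exact hxi this
  have hpow : h ^ p = 1 := by
    -- The group is abelian, so an element fixing `i` fixes the whole orbit of `i`.
    have hcomm : ∀ z : orbitSet cycleGroup k, cycleGroupEquiv (x ^ p) • (z : ℕ) = z := by
      rintro ⟨z, hz⟩
      have hz' : z ∈ MulAction.orbit cycleGroup i := by
        rw [MulAction.orbit_eq_iff.2 hk]
        exact hz
      obtain ⟨g, rfl⟩ := hz'
      obtain ⟨y, rfl⟩ := cycleGroupEquiv.surjective g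
      change cycleGroupEquiv (x ^ p) • (cycleGroupEquiv y • i) = cycleGroupEquiv y • i
      rw [smul_smul, ← map_mul, mul_comm, map_mul, ← smul_smul, cycleGroupEquiv_smul (x ^ p),
        hxpi]
    apply Subtype.ext
    change (MulAction.toPermHom cycleGroup _ (cycleGroupEquiv x)) ^ p = 1
    rw [← map_pow, ← map_pow]
    ext z
    exact hcomm z
  have hs1 : Pi.mulSingle (M := fun k => orbitGroup cycleGroup k) k h ≠ 1 := by
    rwa [Ne, Pi.mulSingle_eq_one_iff]
  refine hn ((cycleGroup_torsion_iff n).1 (realize_torsionSentence _ |>.2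
    ⟨e.symm (Pi.mulSingle k h), fun e1 => hs1 ?_, ?_⟩))
  · exact e.symm.injective (e1.trans (map_one _).symm)
  · rw [← map_pow, ← Pi.mulSingle_pow, hpow, Pi.mulSingle_one, map_one]

end PermTree

/-! ### Primitive recursive evaluation of Gödel numbers, and prenex existential sentences. -/

namespace PermTree

theorem unpair_snd_lt {c : ℕ} (h : c.unpair.1 ≠ 0) : c.unpair.2 < c := by
  have := Nat.unpair_add_le c
  omega

theorem unpair_snd_fst_lt {c : ℕ} (h : c.unpair.1 ≠ 0) : c.unpair.2.unpair.1 < c :=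
  (Nat.unpair_left_le _).trans_lt (unpair_snd_lt h)

theorem unpair_snd_snd_lt {c : ℕ} (h : c.unpair.1 ≠ 0) : c.unpair.2.unpair.2 < c :=
  (Nat.unpair_right_le _).trans_lt (unpair_snd_lt h)

/-- Value of the term with code `c`, where `e = (n, L, l, u)`: the variable `x_j`, `j < n`, takes as
value the `j`-th digit of `u` in base `L`, and the group is `ℤ / L`, written with natural numbers.
The value is `none` for the numbers that are not codes of terms. -/
def termVal (e : ℕ × ℕ × ℕ × ℕ) (c : ℕ) : Option ℕ :=
  if c.unpair.1 = 0 then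
    if c.unpair.2 < e.1 then some (e.2.2.2 / e.2.1 ^ c.unpair.2 % e.2.1) else none
  else if c = Nat.pair 1 0 then some 0
  else if c.unpair.1 = 2 then (termVal e c.unpair.2).map fun a => (e.2.1 - 1) * a
  else if c.unpair.1 = 3 then
    (termVal e c.unpair.2.unpair.1).bind fun a =>
      (termVal e c.unpair.2.unpair.2).map fun b => a + b
  else none
termination_by c
decreasing_by
  · exact unpair_snd_lt (by omega)
  · exact unpair_snd_fst_lt (by omega)
  · exact unpair_snd_snd_lt (by omega)

/-- Three-valued truth value of the quantifier-free formula with code `c`, for `e = (n, L, l, u)`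
as in `termVal`: the first component says that the formula holds, the second that it fails, when
equations are read modulo `L` and inequations modulo `l`. -/
def formulaVal (e : ℕ × ℕ × ℕ × ℕ) (c : ℕ) : Option (Bool × Bool) :=
  if c.unpair.1 = 0 then
    if c.unpair.2 = 0 then some (false, true) else none
  else if c.unpair.1 = 1 then
    (termVal e c.unpair.2.unpair.1).bind fun a =>
      (termVal e c.unpair.2.unpair.2).map fun b =>
        (decide (a % e.2.1 = b % e.2.1), !decide (a % e.2.2.1 = b % e.2.2.1))
  else if c.unpair.1 = 2 then
    (formulaVal e c.unpair.2.unpair.1).bind fun a =>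
      (formulaVal e c.unpair.2.unpair.2).map fun b => (a.2 || b.1, a.1 && b.2)
  else none
termination_by c
decreasing_by
  · exact unpair_snd_fst_lt (by omega)
  · exact unpair_snd_snd_lt (by omega)

theorem getD_map_range {α : Type*} (f : ℕ → Option α) {n d : ℕ} (h : d < n) :
    ((List.range n).map f).getD d none = f d := by
  simp [List.getD, h]

theorem primrec_termVal : Primrec₂ termVal := by
  have he : Primrec fun x : (ℕ × ℕ × ℕ × ℕ) × List (Option ℕ) => x.1 := Primrec.fst
  have hL : Primrec fun x : (ℕ × ℕ × ℕ × ℕ) × List (Option ℕ) => x.1.2.1 :=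
    Primrec.fst.comp (Primrec.snd.comp he)
  have hu : Primrec fun x : (ℕ × ℕ × ℕ × ℕ) × List (Option ℕ) => x.1.2.2.2 :=
    Primrec.snd.comp (Primrec.snd.comp (Primrec.snd.comp he))
  -- In course-of-values recursion the list holds the values at all smaller codes, so its length is
  -- the current code.
  have hc : Primrec fun x : (ℕ × ℕ × ℕ × ℕ) × List (Option ℕ) => x.2.length :=
    Primrec.list_length.comp Primrec.snd
  have h1 : Primrec fun x : (ℕ × ℕ × ℕ × ℕ) × List (Option ℕ) => x.2.length.unpair.1 :=
    Primrec.fst.comp (Primrec.unpair.comp hc)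
  have h2 : Primrec fun x : (ℕ × ℕ × ℕ × ℕ) × List (Option ℕ) => x.2.length.unpair.2 :=
    Primrec.snd.comp (Primrec.unpair.comp hc)
  have hget := Primrec.list_getD (none : Option ℕ)
  have g2 : Primrec fun x : (ℕ × ℕ × ℕ × ℕ) × List (Option ℕ) =>
      x.2.getD x.2.length.unpair.2 none := hget.comp Primrec.snd h2
  have g21 : Primrec fun x : (ℕ × ℕ × ℕ × ℕ) × List (Option ℕ) =>
      x.2.getD x.2.length.unpair.2.unpair.1 none :=
    hget.comp Primrec.snd (Primrec.fst.comp (Primrec.unpair.comp h2))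
  have g22 : Primrec fun x : (ℕ × ℕ × ℕ × ℕ) × List (Option ℕ) =>
      x.2.getD x.2.length.unpair.2.unpair.2 none :=
    hget.comp Primrec.snd (Primrec.snd.comp (Primrec.unpair.comp h2))
  have hvar : Primrec fun x : (ℕ × ℕ × ℕ × ℕ) × List (Option ℕ) =>
      if x.2.length.unpair.2 < x.1.1 then
        some (x.1.2.2.2 / x.1.2.1 ^ x.2.length.unpair.2 % x.1.2.1) else none :=
    Primrec.ite (Primrec.nat_lt.comp h2 (Primrec.fst.comp he))
      (Primrec.option_some.comp (Primrec.nat_mod.comp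
        (Primrec.nat_div.comp hu (primrec_pow.comp hL h2)) hL))
      (Primrec.const none)
  have hinv : Primrec fun x : (ℕ × ℕ × ℕ × ℕ) × List (Option ℕ) =>
      (x.2.getD x.2.length.unpair.2 none).map fun a => (x.1.2.1 - 1) * a :=
    Primrec.option_map g2 (Primrec.nat_mul.comp
      (Primrec.nat_sub.comp (hL.comp Primrec.fst) (Primrec.const 1)) Primrec.snd).to₂
  have hmul : Primrec fun x : (ℕ × ℕ × ℕ × ℕ) × List (Option ℕ) =>
      (x.2.getD x.2.length.unpair.2.unpair.1 none).bind fun a =>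
        (x.2.getD x.2.length.unpair.2.unpair.2 none).map fun b => a + b :=
    Primrec.option_bind g21 (Primrec.option_map (g22.comp Primrec.fst)
      (Primrec.nat_add.comp (Primrec.snd.comp Primrec.fst) Primrec.snd).to₂).to₂
  have hstep := Primrec.option_some.comp
    (Primrec.ite (Primrec.eq.comp h1 (Primrec.const 0)) hvar
      (Primrec.ite (Primrec.eq.comp hc (Primrec.const (Nat.pair 1 0))) (Primrec.const (some 0))
        (Primrec.ite (Primrec.eq.comp h1 (Primrec.const 2)) hinv
          (Primrec.ite (Primrec.eq.comp h1 (Primrec.const 3)) hmul (Primrec.const none)))))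
  refine Primrec.nat_strong_rec _ hstep.to₂ fun e c => ?_
  simp only [List.length_map, List.length_range]
  conv_rhs => rw [termVal]
  congr 1
  -- With tag `0` the second component may equal `c` itself and lie outside the table; that branch
  -- never consults the table.
  by_cases h0 : c.unpair.1 = 0
  · simp only [h0, if_true]
  · rw [getD_map_range _ (unpair_snd_lt h0), getD_map_range _ (unpair_snd_fst_lt h0),
      getD_map_range _ (unpair_snd_snd_lt h0)]

theorem primrec_formulaVal : Primrec₂ formulaVal := by
  have he : Primrec fun x : (ℕ × ℕ × ℕ × ℕ) × List (Option (Bool × Bool)) => x.1 := Primrec.fst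
  have h1 : Primrec fun x : (ℕ × ℕ × ℕ × ℕ) × List (Option (Bool × Bool)) =>
      x.2.length.unpair.1 :=
    Primrec.fst.comp (Primrec.unpair.comp (Primrec.list_length.comp Primrec.snd))
  have h2 : Primrec fun x : (ℕ × ℕ × ℕ × ℕ) × List (Option (Bool × Bool)) =>
      x.2.length.unpair.2 :=
    Primrec.snd.comp (Primrec.unpair.comp (Primrec.list_length.comp Primrec.snd))
  have h21 : Primrec fun x : (ℕ × ℕ × ℕ × ℕ) × List (Option (Bool × Bool)) =>
      x.2.length.unpair.2.unpair.1 := Primrec.fst.comp (Primrec.unpair.comp h2)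
  have h22 : Primrec fun x : (ℕ × ℕ × ℕ × ℕ) × List (Option (Bool × Bool)) =>
      x.2.length.unpair.2.unpair.2 := Primrec.snd.comp (Primrec.unpair.comp h2)
  have hget := Primrec.list_getD (none : Option (Bool × Bool))
  have hmod : ∀ {f : (((ℕ × ℕ × ℕ × ℕ) × List (Option (Bool × Bool))) × ℕ) × ℕ → ℕ},
      Primrec f → PrimrecPred fun y => y.1.2 % f y = y.2 % f y := fun hf =>
    Primrec.eq.comp (Primrec.nat_mod.comp (Primrec.snd.comp Primrec.fst) hf)
      (Primrec.nat_mod.comp Primrec.snd hf)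
  have hbot : Primrec fun x : (ℕ × ℕ × ℕ × ℕ) × List (Option (Bool × Bool)) =>
      if x.2.length.unpair.2 = 0 then some (false, true) else none :=
    Primrec.ite (Primrec.eq.comp h2 (Primrec.const 0)) (Primrec.const _) (Primrec.const none)
  have hee : Primrec fun y : (((ℕ × ℕ × ℕ × ℕ) × List (Option (Bool × Bool))) × ℕ) × ℕ =>
      y.1.1.1.2 := Primrec.snd.comp (he.comp (Primrec.fst.comp Primrec.fst))
  have heq : Primrec fun x : (ℕ × ℕ × ℕ × ℕ) × List (Option (Bool × Bool)) =>
      (termVal x.1 x.2.length.unpair.2.unpair.1).bind fun a =>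
        (termVal x.1 x.2.length.unpair.2.unpair.2).map fun b =>
          (decide (a % x.1.2.1 = b % x.1.2.1), !decide (a % x.1.2.2.1 = b % x.1.2.2.1)) :=
    Primrec.option_bind (primrec_termVal.comp he h21)
      (Primrec.option_map (primrec_termVal.comp (he.comp Primrec.fst) (h22.comp Primrec.fst))
        (Primrec.pair (hmod (Primrec.fst.comp hee)).decide
          (Primrec.not.comp (hmod (Primrec.fst.comp (Primrec.snd.comp hee))).decide)).to₂).to₂
  have himp : Primrec fun x : (ℕ × ℕ × ℕ × ℕ) × List (Option (Bool × Bool)) =>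
      (x.2.getD x.2.length.unpair.2.unpair.1 none).bind fun a =>
        (x.2.getD x.2.length.unpair.2.unpair.2 none).map fun b => (a.2 || b.1, a.1 && b.2) :=
    Primrec.option_bind (hget.comp Primrec.snd h21)
      (Primrec.option_map ((hget.comp Primrec.snd h22).comp Primrec.fst)
        (Primrec.pair
          (Primrec.or.comp (Primrec.snd.comp (Primrec.snd.comp Primrec.fst))
            (Primrec.fst.comp Primrec.snd))
          (Primrec.and.comp (Primrec.fst.comp (Primrec.snd.comp Primrec.fst))
            (Primrec.snd.comp Primrec.snd))).to₂).to₂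
  have hstep := Primrec.option_some.comp
    (Primrec.ite (Primrec.eq.comp h1 (Primrec.const 0)) hbot
      (Primrec.ite (Primrec.eq.comp h1 (Primrec.const 1)) heq
        (Primrec.ite (Primrec.eq.comp h1 (Primrec.const 2)) himp (Primrec.const none))))
  refine Primrec.nat_strong_rec _ hstep.to₂ fun e c => ?_
  simp only [List.length_map, List.length_range]
  conv_rhs => rw [formulaVal]
  congr 1
  by_cases h0 : c.unpair.1 = 0
  · simp only [h0, if_true]
  · rw [getD_map_range _ (unpair_snd_fst_lt h0), getD_map_range _ (unpair_snd_snd_lt h0)]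

theorem exists_term_of_termVal (e : ℕ × ℕ × ℕ × ℕ) (c : ℕ) (h : (termVal e c).isSome) :
    ∃ t : groupLanguage.Term (Empty ⊕ Fin e.1), termCode t = c := by
  induction c using Nat.strong_induction_on with
  | _ c ih =>
    have hc := Nat.pair_unpair c
    rw [termVal] at h
    split_ifs at h with h0 hlt h1 h2 h3
    · exact ⟨.var (.inr ⟨c.unpair.2, hlt⟩), by rw [termCode, ← h0, hc]⟩
    · simp at h
    · exact ⟨.func GroupFunc.one Fin.elim0, by rw [termCode, h1]⟩
    · rw [Option.isSome_map] at h
      obtain ⟨t, ht⟩ := ih _ (unpair_snd_lt h0) h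
      exact ⟨.func GroupFunc.inv fun _ => t, by rw [termCode, ht, ← h2, hc]⟩
    · obtain ⟨w, hw⟩ := Option.isSome_iff_exists.1 h
      obtain ⟨a, ha, hb⟩ := Option.bind_eq_some_iff.1 hw
      obtain ⟨b, hb, -⟩ := Option.map_eq_some_iff.1 hb
      obtain ⟨t, ht⟩ := ih _ (unpair_snd_fst_lt h0) (by rw [ha]; rfl)
      obtain ⟨s, hs⟩ := ih _ (unpair_snd_snd_lt h0) (by rw [hb]; rfl)
      refine ⟨.func GroupFunc.mul ![t, s], ?_⟩
      rw [termCode]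
      simp only [Matrix.cons_val_zero, Matrix.cons_val_one]
      rw [ht, hs, Nat.pair_unpair, ← h3, hc]
    · simp at h

/-- Success of the evaluation certifies that a number codes a quantifier-free formula, so no
separate syntax check is needed. -/
theorem exists_isQF_of_formulaVal (e : ℕ × ℕ × ℕ × ℕ) (c : ℕ) (h : (formulaVal e c).isSome) :
    ∃ φ : groupLanguage.BoundedFormula Empty e.1, φ.IsQF ∧ formulaCode φ = c := by
  induction c using Nat.strong_induction_on with
  | _ c ih =>
    have hc := Nat.pair_unpair c
    rw [formulaVal] at h
    split_ifs at h with h0 h00 h1 h2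
    · exact ⟨⊥, .falsum, by rw [← hc, h0, h00]; rfl⟩
    · simp at h
    · obtain ⟨w, hw⟩ := Option.isSome_iff_exists.1 h
      obtain ⟨a, ha, hb⟩ := Option.bind_eq_some_iff.1 hw
      obtain ⟨b, hb, -⟩ := Option.map_eq_some_iff.1 hb
      obtain ⟨t, ht⟩ := exists_term_of_termVal e _ (by rw [ha]; rfl)
      obtain ⟨s, hs⟩ := exists_term_of_termVal e _ (by rw [hb]; rfl)
      refine ⟨.equal t s, .of_isAtomic (.equal t s), ?_⟩
      rw [formulaCode, ht, hs, Nat.pair_unpair, ← h1, hc]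
    · obtain ⟨w, hw⟩ := Option.isSome_iff_exists.1 h
      obtain ⟨a, ha, hb⟩ := Option.bind_eq_some_iff.1 hw
      obtain ⟨b, hb, -⟩ := Option.map_eq_some_iff.1 hb
      obtain ⟨φ, hφ, hφc⟩ := ih _ (unpair_snd_fst_lt h0) (by rw [ha]; rfl)
      obtain ⟨ψ, hψ, hψc⟩ := ih _ (unpair_snd_snd_lt h0) (by rw [hb]; rfl)
      refine ⟨φ.imp ψ, hφ.imp hψ, ?_⟩
      rw [formulaCode, hφc, hψc, Nat.pair_unpair, ← h2, hc]
    · simp at h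

/-- The Gödel number of `∃ x, φ` as a function of that of `φ`. -/
def exCode (d : ℕ) : ℕ :=
  Nat.pair 2 (Nat.pair (Nat.pair 3 (Nat.pair 2 (Nat.pair d (Nat.pair 0 0)))) (Nat.pair 0 0))

theorem primrec_exCode : Primrec exCode :=
  Primrec₂.natPair.comp (Primrec.const 2) (Primrec₂.natPair.comp
    (Primrec₂.natPair.comp (Primrec.const 3) (Primrec₂.natPair.comp (Primrec.const 2)
      (Primrec₂.natPair.comp Primrec.id (Primrec.const _)))) (Primrec.const _))

/-- `∃` unfolds to `¬∀¬`, and `¬` to implication of `⊥`, whose code is `Nat.pair 0 0`. -/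
theorem formulaCode_ex {n : ℕ} (φ : groupLanguage.BoundedFormula Empty (n + 1)) :
    formulaCode φ.ex = exCode (formulaCode φ) := rfl

theorem formulaCode_exs {n : ℕ} (φ : groupLanguage.BoundedFormula Empty n) :
    formulaCode (n := 0) φ.exs = exCode^[n] (formulaCode φ) := by
  induction n with
  | zero => rfl
  | succ n ih =>
    rw [Function.iterate_succ_apply, ← formulaCode_ex]
    exact ih φ.ex

theorem exists_exs_of_isExistential {n : ℕ} {φ : groupLanguage.BoundedFormula Empty n}
    (h : φ.IsExistential) :
    ∃ m, ∃ ψ : groupLanguage.BoundedFormula Empty m, ψ.IsQF ∧ φ.exs = ψ.exs := by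
  induction h with
  | of_isQF h => exact ⟨_, _, h, rfl⟩
  | ex _ ih => exact ih

theorem isExistential_exs {n : ℕ} {φ : groupLanguage.BoundedFormula Empty n}
    (h : φ.IsExistential) : Language.BoundedFormula.IsExistential (n := 0) φ.exs := by
  induction n with
  | zero => exact h
  | succ n ih => exact ih h.ex

theorem mem_existentialTheory_iff {H : Type*} [Group H] (c : ℕ) :
    c ∈ existentialTheory H ↔ ∃ n, ∃ ψ : groupLanguage.BoundedFormula Empty n, ψ.IsQF ∧
      c = exCode^[n] (formulaCode ψ) ∧ ∃ v : Fin n → H, ψ.Realize default v := by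
  constructor
  · rintro ⟨φ, hφ, hreal, rfl⟩
    obtain ⟨n, ψ, hψ, e⟩ := exists_exs_of_isExistential hφ
    have e' : φ = ψ.exs := e
    refine ⟨n, ψ, hψ, by rw [← formulaCode_exs, ← e'], ?_⟩
    rw [e'] at hreal
    exact Language.BoundedFormula.realize_exs.1 hreal
  · rintro ⟨n, ψ, hψ, rfl, hv⟩
    exact ⟨ψ.exs, isExistential_exs (.of_isQF hψ), Language.BoundedFormula.realize_exs.2 hv,
      (formulaCode_exs ψ).symm⟩

end PermTree

/-! ### The existential theory is `Σ⁰₂`. -/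

namespace PermTree

theorem Agree.congr {m : ℕ} {x : ∀ i, Multiplicative (ZMod (period i))} {k l : ℤ}
    (h : k ≡ l [ZMOD periodLcm m]) (hx : Agree m x k) : Agree m x l := fun i hi => by
  rw [hx i hi, (modEq_periodLcm_iff m k l).1 h i hi]

theorem Agree.eq_iff {m : ℕ} {x y : ∀ i, Multiplicative (ZMod (period i))} {k l : ℕ}
    (hx : Agree m x k) (hy : Agree m y l) :
    (∀ i < m, x i = y i) ↔ k % periodLcm m = l % periodLcm m := by
  have : k % periodLcm m = l % periodLcm m ↔ (k : ℤ) ≡ l [ZMOD periodLcm m] :=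
    Int.natCast_modEq_iff.symm
  rw [this, modEq_periodLcm_iff]
  refine forall₂_congr fun i hi => ?_
  rw [hx i hi, hy i hi, Multiplicative.ofAdd.apply_eq_iff_eq]

/-- This justifies the clause for inverses in `termVal`: `L - 1` represents `-1` modulo `L`. -/
theorem Agree.inv_natCast {m : ℕ} {x : ∀ i, Multiplicative (ZMod (period i))} {k : ℕ}
    (hx : Agree m x k) : Agree m x⁻¹ (((periodLcm m - 1) * k : ℕ) : ℤ) := by
  refine hx.inv.congr ?_
  rw [Nat.cast_mul, Nat.cast_sub (periodLcm_pos m), Int.modEq_iff_dvd]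
  exact ⟨k, by push_cast; ring⟩

theorem exists_natCast_agree (x : procyclic) (m : ℕ) :
    ∃ k : ℕ, k < periodLcm m ∧ Agree m x.1 k := by
  obtain ⟨k, hk⟩ := x.2 m
  have hpos := periodLcm_pos m
  refine ⟨(k % (periodLcm m : ℤ)).toNat, toNat_emod_lt k hpos, hk.congr ?_⟩
  rw [natCast_toNat_emod _ hpos]
  exact (Int.mod_modEq _ _).symm

/-- Truth of a quantifier-free formula in `procyclic`, and truth of its negation, when equations
are required in the first `M` coordinates and inequations in the first `m`. -/
def Approx (m M : ℕ) : {n : ℕ} → groupLanguage.BoundedFormula Empty n →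
    (Fin n → procyclic) → Prop × Prop
  | _, .falsum, _ => (False, True)
  | _, .equal t s, v =>
    (∀ i < M, (t.realize (Sum.elim default v)).1 i = (s.realize (Sum.elim default v)).1 i,
      ¬ ∀ i < m, (t.realize (Sum.elim default v)).1 i = (s.realize (Sum.elim default v)).1 i)
  | _, .rel R _, _ => Empty.elim R
  | _, .imp φ ψ, v =>
    ((Approx m M φ v).2 ∨ (Approx m M ψ v).1, (Approx m M φ v).1 ∧ (Approx m M ψ v).2)
  | _, .all _, _ => (False, False)

theorem termVal_termCode {n M l u : ℕ} {v : Fin n → procyclic}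
    (hv : ∀ j : Fin n,
      Agree M (v j).1 ((u / periodLcm M ^ (j : ℕ) % periodLcm M : ℕ) : ℤ))
    (t : groupLanguage.Term (Empty ⊕ Fin n)) :
    ∃ w : ℕ, termVal (n, periodLcm M, l, u) (termCode t) = some w ∧
      Agree M (t.realize (Sum.elim default v)).1 w := by
  induction t with
  | var x =>
    rcases x with x | j
    · exact x.elim
    · refine ⟨_, ?_, hv j⟩
      rw [termCode, termVal]
      simp [Nat.unpair_pair]
  | func f ts ih =>
    cases f with
    | one =>
      refine ⟨0, ?_, Agree.one M⟩
      rw [termCode, termVal]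
      simp [Nat.unpair_pair]
    | inv =>
      obtain ⟨w, hw, ha⟩ := ih 0
      refine ⟨_, ?_, ha.inv_natCast⟩
      rw [termCode, termVal]
      simp [Nat.unpair_pair, Nat.pair_eq_pair, hw]
    | mul =>
      obtain ⟨w, hw, ha⟩ := ih 0
      obtain ⟨z, hz, hb⟩ := ih 1
      refine ⟨w + z, ?_, ?_⟩
      · rw [termCode, termVal]
        simp [Nat.unpair_pair, Nat.pair_eq_pair, hw, hz]
      · rw [Nat.cast_add]
        exact ha.mul hb

/-- Integers that agree with the values of terms in `M` coordinates also do so in the first `m ≤ M`,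
so one evaluation serves equations and inequations. -/
theorem formulaVal_formulaCode {n m M u : ℕ} (hm : m ≤ M) {v : Fin n → procyclic}
    (hv : ∀ j : Fin n,
      Agree M (v j).1 ((u / periodLcm M ^ (j : ℕ) % periodLcm M : ℕ) : ℤ))
    {φ : groupLanguage.BoundedFormula Empty n} (hφ : φ.IsQF) :
    ∃ b, formulaVal (n, periodLcm M, periodLcm m, u) (formulaCode φ) = some b ∧
      (b.1 = true ↔ (Approx m M φ v).1) ∧ (b.2 = true ↔ (Approx m M φ v).2) := by
  induction hφ with
  | falsum =>
    refine ⟨(false, true), ?_, by simp [Approx], by simp [Approx]⟩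
    rw [formulaCode, formulaVal]
    simp [Nat.unpair_pair]
  | of_isAtomic h =>
    cases h with
    | equal t s =>
      obtain ⟨w, hw, ha⟩ := termVal_termCode (l := periodLcm m) hv t
      obtain ⟨z, hz, hb⟩ := termVal_termCode (l := periodLcm m) hv s
      refine ⟨(decide (w % periodLcm M = z % periodLcm M),
        !decide (w % periodLcm m = z % periodLcm m)), ?_, ?_, ?_⟩
      · rw [Language.Term.bdEqual, formulaCode, formulaVal]
        simp [Nat.unpair_pair, hw, hz]
      · rw [decide_eq_true_iff, ← ha.eq_iff hb]
        rfl
      · rw [Bool.not_eq_true', decide_eq_false_iff_not, ← (ha.mono hm).eq_iff (hb.mono hm)]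
        rfl
    | rel R _ => exact Empty.elim R
  | imp _ _ ih1 ih2 =>
    obtain ⟨a, ha, ha1, ha2⟩ := ih1
    obtain ⟨b, hb, hb1, hb2⟩ := ih2
    refine ⟨(a.2 || b.1, a.1 && b.2), ?_, ?_, ?_⟩
    · rw [formulaCode, formulaVal]
      simp [Nat.unpair_pair, ha, hb]
    · simp only [Bool.or_eq_true, ha2, hb1, Approx]
    · simp only [Bool.and_eq_true, ha1, hb2, Approx]

/-- Keeping truth and falsity as separate components makes every connective monotone in both, so a
larger `M` only strengthens each. -/
theorem Approx.antitone {n : ℕ} {φ : groupLanguage.BoundedFormula Empty n} (hφ : φ.IsQF)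
    {m M M' : ℕ} (h : M' ≤ M) (v : Fin n → procyclic) :
    ((Approx m M φ v).1 → (Approx m M' φ v).1) ∧
      ((Approx m M φ v).2 → (Approx m M' φ v).2) := by
  induction hφ with
  | falsum => exact ⟨id, id⟩
  | of_isAtomic hat =>
    cases hat with
    | equal t s => exact ⟨fun H i hi => H i (hi.trans_le h), id⟩
    | rel R _ => exact Empty.elim R
  | imp _ _ ih1 ih2 => exact ⟨Or.imp ih1.2 ih2.1, And.imp ih1.1 ih2.2⟩

/-- Finitely many inequations hold at `v`, each witnessed in one coordinate; `m₀` exceeds all of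
these, while true equations hold in every coordinate. -/
theorem Approx.exists_of_realize {n : ℕ} {φ : groupLanguage.BoundedFormula Empty n}
    (hφ : φ.IsQF) (v : Fin n → procyclic) :
    ∃ m₀, ∀ m ≥ m₀, ∀ M, (φ.Realize default v → (Approx m M φ v).1) ∧
      (¬ φ.Realize default v → (Approx m M φ v).2) := by
  induction hφ with
  | falsum => exact ⟨0, fun m _ M => ⟨id, fun _ => trivial⟩⟩
  | of_isAtomic hat =>
    cases hat with
    | equal t s =>
      by_cases e : t.realize (Sum.elim default v) = s.realize (Sum.elim default v)
      · exact ⟨0, fun m _ M => ⟨fun _ i _ => by rw [e], fun H =>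
          absurd (Language.BoundedFormula.realize_bdEqual t s |>.2 e) H⟩⟩
      · obtain ⟨i, hi⟩ : ∃ i, (t.realize (Sum.elim default v)).1 i ≠
            (s.realize (Sum.elim default v)).1 i := by
          by_contra! hcon
          exact e (Subtype.ext (funext hcon))
        exact ⟨i + 1, fun m hm M => ⟨fun H =>
          absurd (Language.BoundedFormula.realize_bdEqual t s |>.1 H) e,
          fun _ H => hi (H i hm)⟩⟩
    | rel R _ => exact Empty.elim R
  | @imp φ ψ _ _ ih1 ih2 =>
    obtain ⟨m₁, h1⟩ := ih1
    obtain ⟨m₂, h2⟩ := ih2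
    refine ⟨max m₁ m₂, fun m hm M => ?_⟩
    have h1' := h1 m ((le_max_left _ _).trans hm) M
    have h2' := h2 m ((le_max_right _ _).trans hm) M
    rw [Language.BoundedFormula.realize_imp]
    constructor
    · intro H
      by_cases hφ : φ.Realize default v
      · exact Or.inr (h2'.1 (H hφ))
      · exact Or.inl (h1'.2 hφ)
    · intro H
      rw [Classical.not_imp] at H
      exact ⟨h1'.1 H.1, h2'.2 H.2⟩

theorem Approx.realize {n : ℕ} {φ : groupLanguage.BoundedFormula Empty n} (hφ : φ.IsQF)
    (m : ℕ) (v : Fin n → procyclic) :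
    ((∀ M, (Approx m M φ v).1) → φ.Realize default v) ∧
      ((∀ M, (Approx m M φ v).2) → ¬ φ.Realize default v) := by
  induction hφ with
  | falsum => exact ⟨fun H => H 0, fun _ => id⟩
  | of_isAtomic hat =>
    cases hat with
    | equal t s =>
      refine ⟨fun H => (Language.BoundedFormula.realize_bdEqual t s).2
        (Subtype.ext (funext fun i => H (i + 1) i (Nat.lt_succ_self i))),
        fun H h => H 0 fun i _ => ?_⟩
      rw [(Language.BoundedFormula.realize_bdEqual t s).1 h]
    | rel R _ => exact Empty.elim R
  | @imp φ ψ hφ hψ ih1 ih2 =>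
    rw [Language.BoundedFormula.realize_imp]
    constructor
    · intro H hreal
      refine ih2.1 fun M => ?_
      -- Which disjunct holds may vary with the level. If the second fails at `M`, it fails at every
      -- larger level, so the first holds at `max M M'` and hence at `M'`.
      by_contra hM
      refine ih1.2 (fun M' => ?_) hreal
      rcases H (max M M') with h | h
      · exact (Approx.antitone hφ (le_max_right M M') v).2 h
      · exact absurd ((Approx.antitone hψ (le_max_left M M') v).1 h) hM
    · intro H hreal
      exact ih2.2 (fun M => (H M).2) (hreal (ih1.1 fun M => (H M).1))

theorem continuous_realize {n : ℕ} (t : groupLanguage.Term (Empty ⊕ Fin n)) :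
    Continuous fun v : Fin n → procyclic => t.realize (Sum.elim default v) := by
  induction t with
  | var x =>
    rcases x with x | j
    · exact x.elim
    · exact continuous_apply j
  | func f ts ih =>
    cases f with
    | one => exact continuous_const
    | inv => exact (ih 0).inv
    | mul => exact (ih 0).mul (ih 1)

theorem isClopen_forall_lt_eq {X : Type*} [TopologicalSpace X] {f g : X → procyclic}
    (hf : Continuous f) (hg : Continuous g) (m : ℕ) :
    IsClopen {x | ∀ i < m, (f x).1 i = (g x).1 i} := by
  have : {x | ∀ i < m, (f x).1 i = (g x).1 i} =
      ⋂ i ∈ Finset.range m, {x | (f x).1 i = (g x).1 i} := by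
    ext x
    simp
  rw [this]
  refine isClopen_biInter_finset fun i _ => ?_
  have hpair : Continuous fun x => ((f x).1 i, (g x).1 i) :=
    ((continuous_apply i).comp (continuous_subtype_val.comp hf)).prodMk
      ((continuous_apply i).comp (continuous_subtype_val.comp hg))
  exact (isClopen_discrete {p : _ × _ | p.1 = p.2}).preimage hpair

theorem Approx.isClopen {n : ℕ} {φ : groupLanguage.BoundedFormula Empty n} (hφ : φ.IsQF)
    (m M : ℕ) :
    IsClopen {v | (Approx m M φ v).1} ∧ IsClopen {v | (Approx m M φ v).2} := by
  induction hφ with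
  | falsum => exact ⟨isClopen_empty, isClopen_univ⟩
  | of_isAtomic hat =>
    cases hat with
    | equal t s =>
      exact ⟨isClopen_forall_lt_eq (continuous_realize t) (continuous_realize s) M,
        (isClopen_forall_lt_eq (continuous_realize t) (continuous_realize s) m).compl⟩
    | rel R _ => exact Empty.elim R
  | imp _ _ ih1 ih2 => exact ⟨ih1.2.union ih2.1, ih1.1.inter ih2.2⟩

/-- The decidable relation that defines the existential theory of `procyclic`; the witness `a`
codes the number of variables, the matrix and the level of the inequations. -/
def TheoryRel (x : ℕ × ℕ × ℕ) : Prop :=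
  x.1 = exCode^[x.2.1.unpair.1] x.2.1.unpair.2.unpair.1 ∧
    ∃ u ∈ List.range (periodLcm (x.2.1.unpair.2.unpair.2 + x.2.2) ^ x.2.1.unpair.1),
      (formulaVal (x.2.1.unpair.1, periodLcm (x.2.1.unpair.2.unpair.2 + x.2.2),
        periodLcm x.2.1.unpair.2.unpair.2, u) x.2.1.unpair.2.unpair.1).map Prod.fst = some true

theorem computablePred_theoryRel : ComputablePred TheoryRel := by
  have ha : Primrec fun x : ℕ × ℕ × ℕ => x.2.1 := Primrec.fst.comp Primrec.snd
  have hn : Primrec fun x : ℕ × ℕ × ℕ => x.2.1.unpair.1 :=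
    Primrec.fst.comp (Primrec.unpair.comp ha)
  have hdm : Primrec fun x : ℕ × ℕ × ℕ => x.2.1.unpair.2.unpair :=
    Primrec.unpair.comp (Primrec.snd.comp (Primrec.unpair.comp ha))
  have hd : Primrec fun x : ℕ × ℕ × ℕ => x.2.1.unpair.2.unpair.1 := Primrec.fst.comp hdm
  have hm : Primrec fun x : ℕ × ℕ × ℕ => x.2.1.unpair.2.unpair.2 := Primrec.snd.comp hdm
  have hL : Primrec fun x : ℕ × ℕ × ℕ => periodLcm (x.2.1.unpair.2.unpair.2 + x.2.2) :=
    primrec_periodLcm.comp (Primrec.nat_add.comp hm (Primrec.snd.comp Primrec.snd))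
  have hl : Primrec fun x : ℕ × ℕ × ℕ => periodLcm x.2.1.unpair.2.unpair.2 :=
    primrec_periodLcm.comp hm
  have hrel : PrimrecRel fun (u : ℕ) (x : ℕ × ℕ × ℕ) =>
      (formulaVal (x.2.1.unpair.1, periodLcm (x.2.1.unpair.2.unpair.2 + x.2.2),
        periodLcm x.2.1.unpair.2.unpair.2, u) x.2.1.unpair.2.unpair.1).map Prod.fst = some true :=
    Primrec.eq.comp (Primrec.option_map (primrec_formulaVal.comp
      ((hn.comp Primrec.snd).pair ((hL.comp Primrec.snd).pair
        ((hl.comp Primrec.snd).pair Primrec.fst))) (hd.comp Primrec.snd))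
      (Primrec.fst.comp Primrec.snd).to₂) (Primrec.const _)
  exact (PrimrecPred.and
    (Primrec.eq.comp Primrec.fst
      (Primrec.nat_iterate hn hd (primrec_exCode.comp Primrec.snd).to₂))
    (hrel.exists_mem_list.comp (Primrec.list_range.comp (primrec_pow.comp hL hn))
      Primrec.id)).computablePred

theorem exists_digits (n : ℕ) {L : ℕ} (k : Fin n → ℕ) (hk : ∀ j, k j < L) :
    ∃ u < L ^ n, ∀ j : Fin n, u / L ^ (j : ℕ) % L = k j := by
  let f : Fin n → Fin L := fun j => ⟨k j, hk j⟩
  refine ⟨finFunctionFinEquiv f, (finFunctionFinEquiv f).2, fun j => ?_⟩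
  have := congrArg Fin.val (congrFun (finFunctionFinEquiv.symm_apply_apply f) j)
  exact this

/-- Only the residues of the variables modulo `periodLcm M` matter, and `diag` realizes any tuple of
residues; `u` packs the tuple as digits. -/
theorem exists_approx_iff {n : ℕ} {ψ : groupLanguage.BoundedFormula Empty n} (hψ : ψ.IsQF)
    {m M : ℕ} (hm : m ≤ M) :
    (∃ v, (Approx m M ψ v).1) ↔ ∃ u ∈ List.range (periodLcm M ^ n),
      (formulaVal (n, periodLcm M, periodLcm m, u) (formulaCode ψ)).map Prod.fst = some true := by
  constructor
  · rintro ⟨v, hv⟩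
    choose k hkl hk using fun j => exists_natCast_agree (v j) M
    obtain ⟨u, hu, hdig⟩ := exists_digits n k hkl
    obtain ⟨b, hb, hb1, -⟩ := formulaVal_formulaCode (u := u) hm (v := v)
      (fun j => by rw [hdig]; exact hk j) hψ
    exact ⟨u, List.mem_range.2 hu, by rw [hb, Option.map_some, hb1.2 hv]⟩
  · rintro ⟨u, -, hu⟩
    let v : Fin n → procyclic := fun j =>
      diag ((u / periodLcm M ^ (j : ℕ) % periodLcm M : ℕ) : ℤ)
    obtain ⟨b, hb, hb1, -⟩ := formulaVal_formulaCode (u := u) hm (v := v)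
      (fun j => agree_diag _ _) hψ
    rw [hb, Option.map_some, Option.some_inj] at hu
    exact ⟨v, hb1.1 hu⟩

/-- With `m` fixed the approximate solution sets are closed and decrease with `M`, so compactness of
`procyclic ^ n` gives a common point. Fixing `m` is what makes inequations a closed condition. -/
theorem exists_realize_iff {n : ℕ} {ψ : groupLanguage.BoundedFormula Empty n} (hψ : ψ.IsQF) :
    (∃ v : Fin n → procyclic, ψ.Realize default v) ↔
      ∃ m, ∀ M, ∃ v, (Approx m (m + M) ψ v).1 := by
  constructor
  · rintro ⟨v, hv⟩
    obtain ⟨m, hm⟩ := Approx.exists_of_realize hψ v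
    exact ⟨m, fun M => ⟨v, (hm m le_rfl (m + M)).1 hv⟩⟩
  · rintro ⟨m, hm⟩
    obtain ⟨v, hv⟩ := IsCompact.nonempty_iInter_of_sequence_nonempty_isCompact_isClosed
      (fun M => {v | (Approx m (m + M) ψ v).1})
      (fun M v => (Approx.antitone hψ (by omega) v).1) hm
      (Approx.isClopen hψ m _).1.isClosed.isCompact
      (fun M => (Approx.isClopen hψ m _).1.isClosed)
    rw [Set.mem_iInter] at hv
    exact ⟨v, (Approx.realize hψ m v).1 fun M =>
      (Approx.antitone hψ (by omega : M ≤ m + M) v).1 (hv M)⟩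

theorem isSigma02_existentialTheory_procyclic : IsSigma02 (existentialTheory procyclic) := by
  refine ⟨TheoryRel, computablePred_theoryRel, fun c => ?_⟩
  rw [mem_existentialTheory_iff]
  constructor
  · rintro ⟨n, ψ, hψ, rfl, hv⟩
    obtain ⟨m, hm⟩ := (exists_realize_iff hψ).1 hv
    refine ⟨Nat.pair n (Nat.pair (formulaCode ψ) m), fun M => ?_⟩
    simp only [TheoryRel, Nat.unpair_pair, true_and]
    exact (exists_approx_iff hψ (Nat.le_add_right m M)).1 (hm M)
  · rintro ⟨a, ha⟩
    -- A single level already shows that the number stored in `a` codes a quantifier-free formula.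
    obtain ⟨hc, u, -, hu⟩ := ha 0
    obtain ⟨ψ, hψ, hcode⟩ := exists_isQF_of_formulaVal _ _
      (by rw [← Option.isSome_map, hu]; rfl)
    refine ⟨_, ψ, hψ, by rw [hcode]; exact hc,
      (exists_realize_iff hψ).2 ⟨a.unpair.2.unpair.2, fun M => ?_⟩⟩
    refine (exists_approx_iff hψ (Nat.le_add_right _ M)).2 ?_
    rw [hcode]
    exact (ha M).2

/-- A group isomorphism is an isomorphism of structures for the language of groups. -/
def structureEquiv {G H : Type*} [Group G] [Group H] (e : G ≃* H) : G ≃[groupLanguage] H where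
  toEquiv := e.toEquiv
  map_fun' f x := by
    cases f with
    | one => exact map_one e
    | inv => exact map_inv e (x 0)
    | mul => exact map_mul e (x 0) (x 1)
  map_rel' r := Empty.elim r

theorem existentialTheory_congr {G H : Type*} [Group G] [Group H] (e : G ≃* H) :
    existentialTheory G = existentialTheory H := by
  ext c
  refine exists_congr fun φ => and_congr_right fun _ => and_congr_left fun _ => ?_
  exact Language.StrongHomClass.realize_sentence (structureEquiv e) φ

theorem isSigma02_existentialTheory_cycleGroup : IsSigma02 (existentialTheory cycleGroup) := by
  rw [← existentialTheory_congr cycleGroupEquiv]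
  exact isSigma02_existentialTheory_procyclic

end PermTree

/-! ### `Σ⁰₂`-hardness. -/

namespace PermTree

/-- The Gödel number of the term `x_0 ^ k`. -/
def powCode (k : ℕ) : ℕ :=
  Nat.rec (Nat.pair 1 0) (fun _ c => Nat.pair 3 (Nat.pair c (Nat.pair 0 0))) k

/-- The Gödel number of the negation of a formula as a function of that of the formula. -/
def notCode (d : ℕ) : ℕ := Nat.pair 2 (Nat.pair d (Nat.pair 0 0))

/-- The Gödel number of `torsionSentence p`. -/
def torsionCode (p : ℕ) : ℕ :=
  exCode (notCode (Nat.pair 2 (Nat.pair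
    (notCode (Nat.pair 1 (Nat.pair (Nat.pair 0 0) (Nat.pair 1 0))))
    (notCode (Nat.pair 1 (Nat.pair (powCode p) (Nat.pair 1 0)))))))

theorem termCode_powTerm (k : ℕ) :
    termCode (powTerm (n := 1) (.var (.inr 0)) k) = powCode k := by
  induction k with
  | zero => rfl
  | succ k ih =>
    change Nat.pair 3 (Nat.pair (termCode (powTerm (n := 1) (.var (.inr 0)) k)) (Nat.pair 0 0)) = _
    rw [ih]
    rfl

theorem formulaCode_torsionSentence (p : ℕ) :
    formulaCode (n := 0) (torsionSentence p) = torsionCode p := by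
  rw [torsionCode, ← termCode_powTerm]
  rfl

theorem isExistential_torsionSentence (p : ℕ) :
    Language.BoundedFormula.IsExistential (n := 0) (torsionSentence p) :=
  .ex (.of_isQF (.inf (.not (.of_isAtomic (.equal _ _))) (.of_isAtomic (.equal _ _))))

theorem primrec_powCode : Primrec powCode :=
  Primrec.nat_rec₁ _ (Primrec₂.natPair.comp (Primrec.const 3)
    (Primrec₂.natPair.comp Primrec.snd (Primrec.const _)))

theorem primrec_torsionCode : Primrec torsionCode := by
  have hnot : Primrec notCode := Primrec₂.natPair.comp (Primrec.const 2)
    (Primrec₂.natPair.comp Primrec.id (Primrec.const _))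
  exact primrec_exCode.comp (hnot.comp (Primrec₂.natPair.comp (Primrec.const 2)
    (Primrec₂.natPair.comp (Primrec.const _) (hnot.comp (Primrec₂.natPair.comp (Primrec.const 1)
      (Primrec₂.natPair.comp primrec_powCode (Primrec.const _)))))))

theorem powCode_injective : Function.Injective powCode := by
  refine (strictMono_nat_of_lt_succ fun k => ?_).injective
  change powCode k < Nat.pair 3 (Nat.pair (powCode k) (Nat.pair 0 0))
  have h1 := Nat.left_le_pair (powCode k) (Nat.pair 0 0)
  have h2 := Nat.add_le_pair 3 (Nat.pair (powCode k) (Nat.pair 0 0))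
  omega

theorem torsionCode_injective : Function.Injective torsionCode := fun p q h => by
  simp only [torsionCode, exCode, notCode, Nat.pair_eq_pair, true_and, and_true] at h
  exact powCode_injective h

theorem termCode_injective {n : ℕ} :
    Function.Injective (termCode : groupLanguage.Term (Empty ⊕ Fin n) → ℕ) := by
  intro t
  induction t with
  | var x =>
    intro s h
    rcases x with x | i
    · exact x.elim
    · rcases s with ⟨y | j⟩ | ⟨f, ss⟩
      · exact y.elim
      · simp only [termCode, Nat.pair_eq_pair, true_and] at h
        rw [Fin.ext h]
      · cases f <;> simp [termCode, Nat.pair_eq_pair] at h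
  | func f ts ih =>
    intro s h
    rcases s with ⟨y | j⟩ | ⟨g, ss⟩
    · exact y.elim
    · cases f <;> simp [termCode, Nat.pair_eq_pair] at h
    · cases f <;> cases g <;> simp [termCode, Nat.pair_eq_pair] at h
      · exact congrArg _ (funext fun i => i.elim0)
      · refine congrArg _ (funext fun i => ?_)
        rw [Fin.fin_one_eq_zero i]
        exact ih 0 h
      · refine congrArg _ (funext fun i => ?_)
        match i with
        | 0 => exact ih 0 h.1
        | 1 => exact ih 1 h.2

theorem formulaCode_injective {n : ℕ} :
    Function.Injective (formulaCode : groupLanguage.BoundedFormula Empty n → ℕ) := by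
  intro φ
  induction φ with
  | falsum =>
    intro ψ h
    cases ψ with
    | falsum => rfl
    | rel R _ => exact Empty.elim R
    | _ => simp [formulaCode, Nat.pair_eq_pair] at h
  | equal t₁ t₂ =>
    intro ψ h
    cases ψ with
    | equal s₁ s₂ =>
      simp only [formulaCode, Nat.pair_eq_pair, true_and] at h
      rw [termCode_injective h.1, termCode_injective h.2]
    | rel R _ => exact Empty.elim R
    | _ => simp [formulaCode, Nat.pair_eq_pair] at h
  | rel R _ => exact Empty.elim R
  | imp φ₁ φ₂ ih₁ ih₂ =>
    intro ψ h
    cases ψ with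
    | imp ψ₁ ψ₂ =>
      simp only [formulaCode, Nat.pair_eq_pair, true_and] at h
      rw [ih₁ h.1, ih₂ h.2]
    | rel R _ => exact Empty.elim R
    | _ => simp [formulaCode, Nat.pair_eq_pair] at h
  | all φ ih =>
    intro ψ h
    cases ψ with
    | all ψ =>
      simp only [formulaCode, Nat.pair_eq_pair, true_and] at h
      rw [ih h]
    | rel R _ => exact Empty.elim R
    | _ => simp [formulaCode, Nat.pair_eq_pair] at h

/-- Injectivity of `formulaCode` excludes that another true sentence puts this number into the
theory. -/
theorem torsionCode_mem_iff (G : Type*) [Group G] (p : ℕ) :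
    torsionCode p ∈ existentialTheory G ↔ G ⊨ torsionSentence p := by
  rw [← formulaCode_torsionSentence]
  constructor
  · rintro ⟨φ, -, hφ, h⟩
    rwa [formulaCode_injective h]
  · exact fun h => ⟨_, isExistential_torsionSentence p, h, rfl⟩

/-- To `x` is assigned a program that halts on `a` iff every `a' ≤ a` has a counterexample `b`. Its
domain is an initial segment of `ℕ`, bounded by any `a` with `∀ b, R (x, a, b)`, and all of `ℕ` if
there is none. -/
theorem isSigma02_oneOneReducible_finSet {B : Set ℕ} (hB : IsSigma02 B) :
    OneOneReducible (fun x => x ∈ B) (fun x => x ∈ finSet) := by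
  classical
  obtain ⟨R, hR, hRB⟩ := hB
  let search : ℕ → ℕ → Part ℕ := fun x a => Nat.rfind fun b => Part.some (!decide (R (x, a, b)))
  have hsearch_dom : ∀ x a, (search x a).Dom ↔ ∃ b, ¬ R (x, a, b) := fun x a => by
    refine Nat.rfind_dom.trans ?_
    simp
  have hsearch : Partrec₂ search := by
    have h : Computable₂ fun (p : ℕ × ℕ) (b : ℕ) => !decide (R (p.1, p.2, b)) :=
      Primrec.not.to_comp.comp (hR.decide.comp
        ((Computable.fst.comp Computable.fst).pair
          ((Computable.snd.comp Computable.fst).pair Computable.snd)))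
    exact Partrec.rfind h.partrec₂
  -- The searches for `0, …, a` run in succession, so divergence at one stage propagates to all
  -- later ones.
  let F : ℕ × ℕ → Part ℕ := fun p =>
    Nat.rec (search p.1 0) (fun a IH => IH.bind fun _ => search p.1 (a + 1)) p.2
  have hF_dom : ∀ x a, (F (x, a)).Dom ↔ ∀ a' ≤ a, ∃ b, ¬ R (x, a', b) := fun x a => by
    induction a with
    | zero => simp [F, hsearch_dom]
    | succ a ih =>
      have : (F (x, a + 1)).Dom ↔ (F (x, a)).Dom ∧ (search x (a + 1)).Dom := by
        change ((F (x, a)).bind fun _ => search x (a + 1)).Dom ↔ _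
        rw [Part.bind_dom]
        exact exists_prop
      rw [this, ih, hsearch_dom]
      constructor
      · rintro ⟨h1, h2⟩ a' ha'
        rcases Nat.le_succ_iff.1 ha' with h | rfl
        · exact h1 a' h
        · exact h2
      · exact fun h => ⟨fun a' ha' => h a' (ha'.trans (Nat.le_succ a)), h _ le_rfl⟩
  have hF : Partrec F := by
    have h : Partrec₂ fun (p : ℕ × ℕ) (q : ℕ × ℕ) => search p.1 (q.1 + 1) :=
      hsearch.comp (Computable.fst.comp Computable.fst)
        (Computable.succ.comp (Computable.fst.comp Computable.snd))
    exact Partrec.nat_rec Computable.snd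
      (hsearch.comp Computable.fst (Computable.const 0)) h
  have hF' : Partrec fun n : ℕ => F n.unpair := hF.comp Computable.unpair
  obtain ⟨c, hc⟩ := Nat.Partrec.Code.exists_code.1 (Partrec.nat_iff.1 hF')
  have hW : ∀ x, W (Encodable.encode (c.curry x)) = {a | ∀ a' ≤ a, ∃ b, ¬ R (x, a', b)} :=
    fun x => by
      ext a
      simp only [W, Set.mem_ofPred_eq, Denumerable.ofNat_encode, Nat.Partrec.Code.eval_curry, hc,
        Nat.unpair_pair, hF_dom]
  -- Currying is computable and injective in the parameter, so the reduction is one-one.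
  refine ⟨fun x => Encodable.encode (c.curry x),
    (Primrec.encode.comp (Nat.Partrec.Code.primrec₂_curry.comp (Primrec.const c)
      Primrec.id)).to_comp,
    fun x y h => (Nat.Partrec.Code.curry_inj (Encodable.encode_injective h)).2, fun x => ?_⟩
  change x ∈ B ↔ (W _).Finite
  rw [hW, hRB]
  constructor
  · rintro ⟨a, ha⟩
    refine (Set.finite_Iio a).subset fun a' ha' => ?_
    by_contra hlt
    obtain ⟨b, hb⟩ := ha' a (not_lt.1 hlt)
    exact hb (ha b)
  · intro hfin
    by_contra! h
    have : {a | ∀ a' ≤ a, ∃ b, ¬ R (x, a', b)} = Set.univ :=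
      Set.eq_univ_of_forall fun a a' _ => h a'
    rw [this] at hfin
    exact Set.infinite_univ hfin

theorem finSet_oneOneReducible :
    OneOneReducible (fun n => n ∈ finSet) (fun c => c ∈ existentialTheory cycleGroup) :=
  ⟨fun n => torsionCode (Nat.nth Nat.Prime n),
    (primrec_torsionCode.comp primrec_nth_prime).to_comp,
    fun _ _ h => Nat.nth_injective Nat.infinite_setOfPred_prime (torsionCode_injective h),
    fun n => (cycleGroup_torsion_iff n).symm.trans
      (torsionCode_mem_iff cycleGroup (Nat.nth Nat.Prime n)).symm⟩

theorem isSigma02Complete_existentialTheory_cycleGroup :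
    IsSigma02Complete (existentialTheory cycleGroup) :=
  ⟨isSigma02_existentialTheory_cycleGroup, fun _ hB =>
    (isSigma02_oneOneReducible_finSet hB).trans finSet_oneOneReducible⟩

end PermTree

theorem mainTheorem6 :
    ∃ G : Subgroup (Equiv.Perm ℕ),
      PermTree.IsProfiniteSubgroup G ∧
      ¬ PermTree.OrbitIndependent G ∧
      PermTree.IsComputableTree (PermTree.tree G) ∧
      PermTree.IsSigma02Complete (PermTree.existentialTheory G) ∧
      ∀ n : ℕ, G ⊨ PermTree.torsionSentence (Nat.nth Nat.Prime n) ↔ n ∈ PermTree.finSet :=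
  ⟨PermTree.cycleGroup, PermTree.isProfiniteSubgroup_cycleGroup,
    PermTree.not_orbitIndependent_cycleGroup, PermTree.isComputableTree_cycleGroup,
    PermTree.isSigma02Complete_existentialTheory_cycleGroup, PermTree.cycleGroup_torsion_iff⟩
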